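/- Let $\mathbb{H}$ be the Heisenberg group, i.e. $\mathbb{R}^3$ with the product $(x,y,z)\cdot(x',y',z')=\left(x+x',\,y+y',\,z+z'+\tfrac{xy'-yx'}{2}\right)$, and let $d$ be its Carnot–Carathéodory metric: $d(p,q)$ is the infimum of $\int_0^1\sqrt{\gamma_x'^2+\gamma_y'^2}\,dt$ over all horizontal curves $\gamma:[0,1]\to\mathbb{H}$ from $p$ to $q$ (Lipschitz curves almost everywhere tangent to the span of $X=(1,0,-y/2)$ and $Y=(0,1,x/2)$). Write $B(p,r)$ for the open $d$-balls, $Y^t=(0,t,0)$, $V_0=\{y=0\}$ with Lebesgue measure $\mu$, and $\Pi:\mathbb{H}\to V_0$, $\Pi(x,y,z)=(x,0,z-\tfrac{xy}{2})$. For $f:V_0\to\mathbb{R}$ let $\Gamma_f=\{v\cdot Y^{f(v)}\mid v\in V_0\}$. Call $\Gamma_f$ an entire intrinsic Lipschitz graph, and $f$ intrinsic Lipschitz, if there is $\lambda\in(0,1)$ with $|y(q)-y(p)|\le\lambda\, d(p,q)$ for all $p,q\in\Gamma_f$. Let $\nabla_f f\in L^{\infty}_{\mathrm{loc}}(V_0)$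 be the distributional intrinsic gradient, i.e. $\int_{V_0}\nabla_f f\,\psi\,d\mu=\int_{V_0}\left(-f\,\partial_x\psi+\tfrac{f^2}{2}\,\partial_z\psi\right)d\mu$ for all $\psi\in C^1_c(V_0)$. For $W\subset\mathbb{H}$ bounded and open put $E_W(\Gamma_f)=\tfrac12\int_{\Pi(W\cap\Gamma_f)}(\nabla_f f)^2\,d\mu$. The epigraph of $\Gamma=\Gamma_f$ is $\Gamma^+=\{pY^t\mid p\in\Gamma,\ t\ge 0\}$. An entire intrinsic Lipschitz graph $\Gamma$ minimizes energy on an open set $W\subset\mathbb{H}$ if $$E_{W\cap B(p,r)}(\Gamma)\le E_{W\cap B(p,r)}(\Lambda)$$ for all $p\in\mathbb{H}$, $r>0$, and all entire intrinsic Lipschitz graphs $\Lambda$ such that the closure of $\Gamma^+\mathbin{\triangle}\Lambda^+$ is compact and contained in $W\cap B(p,r)$. For $a,b\in\mathbb{R}\setminus\{0\}$ let $s_{a,b}(x,y,z)=(ax,by,abz)$ (stretch), and for $b\in\mathbb{R}$ let $P_b(x,y,z)=(x,y+bx,z)$ (shear). **Statement.** Let $W\subset\mathbb{H}$ be open and let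 $\Gamma$ be an entire intrinsic Lipschitz graph that minimizes energy on $W$. Let $h:\mathbb{H}\to\mathbb{H}$ be a left translation $p\mapsto h_0p$ with $h_0\in\mathbb{H}$, a stretch $s_{a,b}$ with $a,b\neq0$, or a shear $P_b$ with $b\in\mathbb{R}$. Then $h(\Gamma)$ is an entire intrinsic Lipschitz graph that minimizes energy on $h(W)$. -/

import Mathlib

open Set MeasureTheory
open scoped ENNReal NNReal Topology symmDiff

noncomputable section

/-- The underlying set `ℝ³` of the Heisenberg group. -/
@[ext]
structure Heis where
  x : ℝ
  y : ℝ
  z : ℝ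

namespace Heis

instance : Mul Heis :=
  ⟨fun p q => ⟨p.x + q.x, p.y + q.y, p.z + q.z + (p.x * q.y - p.y * q.x) / 2⟩⟩

instance : One Heis := ⟨⟨0, 0, 0⟩⟩

instance : Inv Heis := ⟨fun p => ⟨-p.x, -p.y, -p.z⟩⟩

@[simp] theorem mul_x (p q : Heis) : (p * q).x = p.x + q.x := rfl
@[simp] theorem mul_y (p q : Heis) : (p * q).y = p.y + q.y := rfl
@[simp] theorem mul_z (p q : Heis) :
    (p * q).z = p.z + q.z + (p.x * q.y - p.y * q.x) / 2 := rfl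
@[simp] theorem one_x : (1 : Heis).x = 0 := rfl
@[simp] theorem one_y : (1 : Heis).y = 0 := rfl
@[simp] theorem one_z : (1 : Heis).z = 0 := rfl
@[simp] theorem inv_x (p : Heis) : (p⁻¹).x = -p.x := rfl
@[simp] theorem inv_y (p : Heis) : (p⁻¹).y = -p.y := rfl
@[simp] theorem inv_z (p : Heis) : (p⁻¹).z = -p.z := rfl

/-- The Heisenberg group law on `ℝ³`. -/
instance : Group Heis :=
  Group.ofLeftAxioms
    (by intro p q r; ext <;> simp <;> ring)
    (by intro p; ext <;> simp)
    (by intro p; ext <;> simp; ring)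

/-- The coordinates of a point, as an element of `ℝ × ℝ × ℝ`. -/
def coords (p : Heis) : ℝ × ℝ × ℝ := (p.x, p.y, p.z)

/-- The Euclidean topology of `ℝ³`. -/
instance : TopologicalSpace Heis := TopologicalSpace.induced coords inferInstance

/-- The one-parameter subgroup `Y^t = (0, t, 0)`. -/
def expY (t : ℝ) : Heis := ⟨0, t, 0⟩

/-- The stretch map `s_{a,b}(x, y, z) = (a x, b y, a b z)`. -/
def stretch (a b : ℝ) (p : Heis) : Heis := ⟨a * p.x, b * p.y, a * b * p.z⟩

/-- The shear map `P_b(x, y, z) = (x, y + b x, z)`. -/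
def shear (b : ℝ) (p : Heis) : Heis := ⟨p.x, p.y + b * p.x, p.z⟩

/-- `γ`, restricted to `[0, 1]`, is a horizontal curve: it is Lipschitz with respect to the
Euclidean structure (the sup norm used here on `ℝ × ℝ × ℝ` is equivalent to the Euclidean norm), and
for almost every `t` its velocity is `x'(t) X + y'(t) Y`, a combination of the left-invariant fields
`X = (1, 0, -y/2)` and `Y = (0, 1, x/2)` at the point `γ t`. -/
def IsHorizontal (γ : ℝ → Heis) : Prop :=
  (∃ K : ℝ≥0, LipschitzOnWith K (fun t => coords (γ t)) (Icc 0 1)) ∧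
  ∀ᵐ t ∂(volume.restrict (Icc (0 : ℝ) 1)),
    deriv (fun s => (γ s).z) t =
      deriv (fun s => (γ s).x) t * (-(γ t).y / 2) + deriv (fun s => (γ s).y) t * ((γ t).x / 2)

/-- The length of a horizontal curve: the Euclidean length of its projection to the `xy`-plane. -/
def horizontalLength (γ : ℝ → Heis) : ℝ :=
  ∫ t in (0 : ℝ)..1, √(deriv (fun s => (γ s).x) t ^ 2 + deriv (fun s => (γ s).y) t ^ 2)

/-- The lengths of the horizontal curves from `p` to `q`. -/
def horizontalLengths (p q : Heis) : Set ℝ :=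
  {l | ∃ γ : ℝ → Heis, IsHorizontal γ ∧ γ 0 = p ∧ γ 1 = q ∧ horizontalLength γ = l}

/-- The Carnot–Carathéodory distance. -/
def ccDist (p q : Heis) : ℝ := sInf (horizontalLengths p q)

/-- Any two points are joined by a horizontal curve, so the infimum defining `ccDist` is taken over
a nonempty set of nonnegative numbers. -/
theorem horizontalLengths_nonempty (p q : Heis) : (horizontalLengths p q).Nonempty := by
  obtain ⟨u, hu⟩ : ∃ u : Heis, u = p⁻¹ * q := ⟨_, rfl⟩
  obtain ⟨c, hc⟩ : ∃ c : ℝ, c = 5 * u.y - 30 * u.z := ⟨_, rfl⟩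
  let c1 : ℝ → ℝ := fun t => u.x * t + (t - t ^ 2)
  let c2 : ℝ → ℝ := fun t => u.y * t + c * (t - 3 * t ^ 2 + 2 * t ^ 3)
  let c3 : ℝ → ℝ := fun t => (u.x * c * (t ^ 4 - t ^ 3) + u.y * (t ^ 3 / 3)
    + c * (-2 * t ^ 3 / 3 + t ^ 4 - 2 * t ^ 5 / 5)) / 2
  let γ : ℝ → Heis := fun t => p * ⟨c1 t, c2 t, c3 t⟩
  refine ⟨_, γ, ⟨?_, ?_⟩, ?_, ?_, rfl⟩
  · have h : ContDiff ℝ 1 (fun t => coords (γ t)) := by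
      simp only [coords, γ, c1, c2, c3, mul_x, mul_y, mul_z]
      fun_prop
    exact h.contDiffOn.exists_lipschitzOnWith (by simp) (convex_Icc 0 1) isCompact_Icc
  · refine Filter.Eventually.of_forall fun t => ?_
    have h1 : HasDerivAt c1 (u.x + (1 - 2 * t)) t := by
      refine HasDerivAt.congr_deriv (((hasDerivAt_id t).const_mul u.x).add
        ((hasDerivAt_id t).sub ((hasDerivAt_id t).pow 2))) ?_
      simp
    have h2 : HasDerivAt c2 (u.y + c * (1 - 6 * t + 6 * t ^ 2)) t := by
      refine HasDerivAt.congr_deriv (((hasDerivAt_id t).const_mul u.y).add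
        ((((hasDerivAt_id t).sub (((hasDerivAt_id t).pow 2).const_mul 3)).add
          (((hasDerivAt_id t).pow 3).const_mul 2)).const_mul c)) ?_
      simp only [id]; push_cast; ring
    have h3 : HasDerivAt c3 ((u.x * c * (4 * t ^ 3 - 3 * t ^ 2) + u.y * t ^ 2
        + c * (-2 * t ^ 2 + 4 * t ^ 3 - 2 * t ^ 4)) / 2) t := by
      have e := ((((((hasDerivAt_id t).pow 4).sub ((hasDerivAt_id t).pow 3)).const_mul (u.x * c)).add
        ((((hasDerivAt_id t).pow 3).div_const 3).const_mul u.y)).add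
        ((((((hasDerivAt_id t).pow 3).const_mul (-2)).div_const 3).add
          ((hasDerivAt_id t).pow 4) |>.sub
          ((((hasDerivAt_id t).pow 5).const_mul 2).div_const 5)).const_mul c)).div_const 2
      refine HasDerivAt.congr_deriv e ?_
      simp only [id]; push_cast; ring
    have g1 : deriv (fun s => (γ s).x) t = u.x + (1 - 2 * t) := (h1.const_add p.x).deriv
    have g2 : deriv (fun s => (γ s).y) t = u.y + c * (1 - 6 * t + 6 * t ^ 2) :=
      (h2.const_add p.y).deriv
    have g3 := ((h3.const_add p.z).add
      (((h2.const_mul p.x).sub (h1.const_mul p.y)).div_const 2)).deriv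
    rw [g1, g2]
    refine g3.trans ?_
    simp only [γ, c1, c2, mul_x, mul_y]
    ring
  · ext <;> simp [γ, c1, c2, c3]
  · have hq : q = p * u := by rw [hu]; simp
    rw [hq]
    ext
    · simp [γ, c1]
    · simp [γ, c2]; right; norm_num
    · simp [γ, c1, c2, c3, hc]; ring

/-- The open ball of the Carnot–Carathéodory metric. -/
def ccBall (p : Heis) (r : ℝ) : Set Heis := {q | ccDist p q < r}

/-- The `xz`-plane `V₀ = {y = 0}`, parametrized by its coordinates `(x, z)`. -/
def ofV0 (v : ℝ × ℝ) : Heis := ⟨v.1, 0, v.2⟩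

/-- The projection `Π(x, y, z) = (x, y, z) · Y^{-y} = (x, 0, z - x y / 2)` to `V₀`. -/
def projV0 (p : Heis) : ℝ × ℝ := (p.x, p.z - p.x * p.y / 2)

/-- The intrinsic graph `Γ_f = {v · Y^{f(v)} | v ∈ V₀}` of a function `f : V₀ → ℝ`. -/
def intrinsicGraph (f : ℝ × ℝ → ℝ) : Set Heis := range fun v => ofV0 v * expY (f v)

/-- `Γ` is an intrinsic `λ`-Lipschitz set for some `λ ∈ (0, 1)`. -/
def IsIntrinsicLipschitzSet (Γ : Set Heis) : Prop :=
  ∃ l ∈ Ioo (0 : ℝ) 1, ∀ p ∈ Γ, ∀ q ∈ Γ, |q.y - p.y| ≤ l * ccDist p q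

/-- `f : V₀ → ℝ` is an intrinsic Lipschitz function, i.e. `Γ_f` is an entire intrinsic Lipschitz
graph. -/
def IsIntrinsicLipschitz (f : ℝ × ℝ → ℝ) : Prop := IsIntrinsicLipschitzSet (intrinsicGraph f)

/-- `f` is continuous and `θ ∈ L^∞_loc(V₀)` is its intrinsic gradient `∇_f f = ∂_x f - f ∂_z f` in
the sense of distributions: `∫ θ ψ = ∫ (-f ∂_x ψ + (f² / 2) ∂_z ψ)` for all `ψ ∈ C¹_c`. -/
def IsIntrinsicGradient (f θ : ℝ × ℝ → ℝ) : Prop :=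
  Continuous f ∧
  (∀ K : Set (ℝ × ℝ), IsCompact K → MemLp θ ∞ (volume.restrict K)) ∧
  ∀ ψ : ℝ × ℝ → ℝ, ContDiff ℝ 1 ψ → HasCompactSupport ψ →
    ∫ v, θ v * ψ v = ∫ v, (-f v * fderiv ℝ ψ v (1, 0) + f v ^ 2 / 2 * fderiv ℝ ψ v (0, 1))

/-- The intrinsic Dirichlet energy `E_U(f) = (1/2) ∫_U (∇_f f)² dμ`. The intrinsic gradient is unique
up to null sets when it exists (as it does for intrinsic Lipschitz `f`), so the infimum only picks
the gradient; the energy of a function without intrinsic gradient is `∞`. -/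
def dirichletEnergy (f : ℝ × ℝ → ℝ) (U : Set (ℝ × ℝ)) : ℝ≥0∞ :=
  ⨅ (θ : ℝ × ℝ → ℝ) (_ : IsIntrinsicGradient f θ),
    (1 / 2) * ∫⁻ v in U, ENNReal.ofReal (θ v ^ 2)

/-- The energy `E_W(Γ_f) = E_{Π(W ∩ Γ_f)}(f)` of the graph of `f` on `W ⊆ ℍ`. -/
def graphEnergy (f : ℝ × ℝ → ℝ) (W : Set Heis) : ℝ≥0∞ :=
  dirichletEnergy f (projV0 '' (W ∩ intrinsicGraph f))

/-- The epigraph `Γ⁺ = {p Y^t | p ∈ Γ, t ≥ 0}`. -/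
def epigraph (Γ : Set Heis) : Set Heis := {q | ∃ p ∈ Γ, ∃ t : ℝ, 0 ≤ t ∧ q = p * expY t}

/-- `S ⋐ T`: the closure of `S` is compact and contained in `T`. -/
def CompactlyContained (S T : Set Heis) : Prop := IsCompact (closure S) ∧ closure S ⊆ T

/-- `Γ` is an entire intrinsic Lipschitz graph `Γ_f` that is energy-minimizing on `W`: for all balls
`B(p, r)` and all entire intrinsic Lipschitz graphs `Λ = Γ_g` with `Γ⁺ ∆ Λ⁺ ⋐ W ∩ B(p, r)`,
`E_{W ∩ B(p, r)}(Γ) ≤ E_{W ∩ B(p, r)}(Λ)`. -/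
def IsEnergyMinimizingOn (Γ W : Set Heis) : Prop :=
  ∃ f : ℝ × ℝ → ℝ, IsIntrinsicLipschitz f ∧ Γ = intrinsicGraph f ∧
    ∀ (p : Heis) (r : ℝ), 0 < r → ∀ g : ℝ × ℝ → ℝ, IsIntrinsicLipschitz g →
      CompactlyContained (epigraph Γ ∆ epigraph (intrinsicGraph g)) (W ∩ ccBall p r) →
      graphEnergy f (W ∩ ccBall p r) ≤ graphEnergy g (W ∩ ccBall p r)

end Heis

end

noncomputable section

namespace Heis

/-! ### Estimates for the Carnot–Carathéodory distance -/

/-! ### Plane curves: displacement and swept area against length. -/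

section PlaneCurves

variable {f g : ℝ → ℝ} {K : ℝ≥0}

/-! All three kinds of map carry fibres `v Y^t` affinely to fibres, with fibre scale `β`, `x`-scale
`α` and a displacement `lift x = l + m x`; they are treated at once as a `GraphMap`. Such a map
sends the graph of `f` to the graph of `S.push f`, and a gradient `θ` of `f` becomes `(β θ + m) / α`
in the new coordinates (`isIntrinsicGradient_push`). The base map has constant Jacobian, so the new
energy is, up to a positive factor, `β² ∫ θ² + 2 β m ∫ θ` plus a constant. For a competitor that
differs from `f` only over a relatively compact set, the linear term does not change: the gradient
is a divergence, so its integral over the closed set of difference is fixed by the values outside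
(`setIntegral_closure_eq`). Hence energy comparisons are preserved
(`setIntegral_pushGradient_le_iff`).

Two points remain. The maps need not send balls to balls; but an energy comparison only sees the
closure of `{f ≠ g}` (`graphEnergy_le_iff`), so any ball containing the preimage of the given one
will do. Also, distances may be distorted by a factor that spoils a Lipschitz constant below `1`; so
the Lipschitz condition is first rewritten as a bound of `y²` by a constant times `x² + |w|`, with
`w` the second coordinate of the projection to `V₀` (`isIntrinsicLipschitzSet_iff`). That form
survives with a new constant. It rests on two-sided estimates of the Carnot–Carathéodory distance
that are sharp in the `y` direction. -/

theorem intervalIntegrable_speed (hf : LipschitzOnWith K f (Icc 0 1))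
    (hg : LipschitzOnWith K g (Icc 0 1)) :
    IntervalIntegrable (fun t => √(deriv f t ^ 2 + deriv g t ^ 2)) volume 0 1 := by
  rw [← uIcc_of_le zero_le_one] at hf hg
  have h1 := hf.absolutelyContinuousOnInterval.intervalIntegrable_deriv
  have h2 := hg.absolutelyContinuousOnInterval.intervalIntegrable_deriv
  refine (h1.abs.add h2.abs).mono_fun ?_ (Filter.Eventually.of_forall fun t => ?_)
  · exact ((((measurable_deriv f).pow_const 2).add
      ((measurable_deriv g).pow_const 2)).sqrt).aestronglyMeasurable
  · simp only [Real.norm_eq_abs]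
    rw [abs_of_nonneg (Real.sqrt_nonneg _),
      abs_of_nonneg (add_nonneg (abs_nonneg _) (abs_nonneg _))]
    refine Real.sqrt_le_iff.2 ⟨add_nonneg (abs_nonneg _) (abs_nonneg _), ?_⟩
    nlinarith [sq_abs (deriv f t), sq_abs (deriv g t),
      mul_nonneg (abs_nonneg (deriv f t)) (abs_nonneg (deriv g t))]

/-- Pair the velocity with the vector `(ξ, η)` of the two increments and apply Cauchy–Schwarz
pointwise. The time `t` is free in `f` only: this bounds the horizontal deviation at every moment by
what the total `g`-increment leaves of the length. -/
theorem sq_add_sq_le_length_sq (hf : LipschitzOnWith K f (Icc 0 1))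
    (hg : LipschitzOnWith K g (Icc 0 1)) {t : ℝ} (ht : t ∈ Icc (0 : ℝ) 1) :
    (f t - f 0) ^ 2 + (g 1 - g 0) ^ 2 ≤
      (∫ s in (0 : ℝ)..1, √(deriv f s ^ 2 + deriv g s ^ 2)) ^ 2 := by
  have hint := intervalIntegrable_speed hf hg
  obtain ⟨ξ, hξ⟩ : ∃ ξ, ξ = f t - f 0 := ⟨_, rfl⟩
  obtain ⟨η, hη⟩ : ∃ η, η = g 1 - g 0 := ⟨_, rfl⟩
  obtain ⟨L, hL⟩ : ∃ L, L = ∫ s in (0 : ℝ)..1, √(deriv f s ^ 2 + deriv g s ^ 2) := ⟨_, rfl⟩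
  have hft : LipschitzOnWith K f (uIcc 0 t) := by
    rw [uIcc_of_le ht.1]; exact hf.mono (Icc_subset_Icc_right ht.2)
  rw [← uIcc_of_le zero_le_one] at hf hg
  have h1 := hf.absolutelyContinuousOnInterval.intervalIntegrable_deriv
  have h2 := hg.absolutelyContinuousOnInterval.intervalIntegrable_deriv
  -- Absolute values make the integrand nonnegative, so the range `[0, t]` may be enlarged to `[0,
  -- 1]`.
  have e1 : ξ * ξ ≤ ∫ s in (0 : ℝ)..1, |ξ| * |deriv f s| := by
    have a1 : ξ * ξ = ∫ s in (0 : ℝ)..t, ξ * deriv f s := by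
      rw [intervalIntegral.integral_const_mul,
        hft.absolutelyContinuousOnInterval.integral_deriv_eq_sub, ← hξ]
    rw [a1]
    have h1t := hft.absolutelyContinuousOnInterval.intervalIntegrable_deriv
    refine (intervalIntegral.integral_mono_on ht.1 (h1t.const_mul ξ) (h1t.abs.const_mul |ξ|)
      fun s _ => ?_).trans ?_
    · rw [← abs_mul]; exact le_abs_self _
    · exact intervalIntegral.integral_mono_interval le_rfl ht.1 ht.2
        (Filter.Eventually.of_forall fun s => mul_nonneg (abs_nonneg _) (abs_nonneg _))
        (h1.abs.const_mul |ξ|)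
  have e2 : η * η = ∫ s in (0 : ℝ)..1, η * deriv g s := by
    rw [intervalIntegral.integral_const_mul,
      hg.absolutelyContinuousOnInterval.integral_deriv_eq_sub, ← hη]
  have e3 : ξ * ξ + η * η ≤ √(ξ ^ 2 + η ^ 2) * L := by
    rw [hL, ← intervalIntegral.integral_const_mul]
    calc _ ≤ (∫ s in (0 : ℝ)..1, |ξ| * |deriv f s|) + ∫ s in (0 : ℝ)..1, η * deriv g s :=
          add_le_add e1 e2.le
      _ = ∫ s in (0 : ℝ)..1, (|ξ| * |deriv f s| + η * deriv g s) :=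
          (intervalIntegral.integral_add (h1.abs.const_mul _) (h2.const_mul _)).symm
      _ ≤ _ := by
        refine intervalIntegral.integral_mono_on zero_le_one
          ((h1.abs.const_mul _).add (h2.const_mul _)) (hint.const_mul _) fun s _ => ?_
        rw [← Real.sqrt_mul (by positivity)]
        apply Real.le_sqrt_of_sq_le
        nlinarith [sq_nonneg (|ξ| * deriv g s - η * |deriv f s|), sq_abs ξ, sq_abs (deriv f s)]
  have hL0 : 0 ≤ L := by
    rw [hL]; exact intervalIntegral.integral_nonneg zero_le_one fun s _ => Real.sqrt_nonneg _
  rw [← hξ, ← hη, ← hL]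
  have e4 := Real.sq_sqrt (show 0 ≤ ξ ^ 2 + η ^ 2 by positivity)
  have e5 := Real.sqrt_nonneg (ξ ^ 2 + η ^ 2)
  have e6 : √(ξ ^ 2 + η ^ 2) ≤ L := by
    by_contra! hlt
    nlinarith
  nlinarith

theorem abs_integral_mul_deriv_le (hf : LipschitzOnWith K f (Icc 0 1))
    (hg : LipschitzOnWith K g (Icc 0 1)) {L : ℝ}
    (hL : L = ∫ s in (0 : ℝ)..1, √(deriv f s ^ 2 + deriv g s ^ 2)) :
    |∫ s in (0 : ℝ)..1, (f s - f 0) * deriv g s| ≤ √(L ^ 2 - (g 1 - g 0) ^ 2) * L := by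
  have hint := intervalIntegrable_speed hf hg
  have hb : ∀ t ∈ Icc (0 : ℝ) 1, |f t - f 0| ≤ √(L ^ 2 - (g 1 - g 0) ^ 2) := fun t ht => by
    apply Real.abs_le_sqrt
    have := sq_add_sq_le_length_sq hf hg ht
    rw [hL]; linarith
  conv_rhs => rw [hL, ← intervalIntegral.integral_const_mul, ← hL]
  rw [← Real.norm_eq_abs]
  refine intervalIntegral.norm_integral_le_of_norm_le zero_le_one
    (Filter.Eventually.of_forall fun s hs => ?_) (hint.const_mul _)
  rw [Real.norm_eq_abs, abs_mul]
  refine mul_le_mul (hb s (Ioc_subset_Icc_self hs)) ?_ (abs_nonneg _) (Real.sqrt_nonneg _)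
  apply Real.le_sqrt_of_sq_le
  rw [sq_abs]; nlinarith [sq_nonneg (deriv f s)]

end PlaneCurves

theorem horizontalLength_nonneg (γ : ℝ → Heis) : 0 ≤ horizontalLength γ :=
  intervalIntegral.integral_nonneg zero_le_one fun _ _ => Real.sqrt_nonneg _

theorem bddBelow_horizontalLengths (p q : Heis) : BddBelow (horizontalLengths p q) :=
  ⟨0, by rintro _ ⟨γ, -, -, -, rfl⟩; exact horizontalLength_nonneg γ⟩

/-- Integrating the horizontality condition by parts gives `u.z + u.x u.y / 2 = ∫ (x - x(0)) dy`,
which the area estimate bounds by `S L` with `S² = L² - u.y²`. Passing to the projection costs a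
further `|u.x u.y| ≤ S L`. The factor `S` makes the bound degenerate exactly when the curve is
almost a `Y`-line. -/
theorem length_bounds {γ : ℝ → Heis} (hγ : IsHorizontal γ) {u : Heis}
    (hu : u = (γ 0)⁻¹ * γ 1) :
    u.x ^ 2 + u.y ^ 2 ≤ horizontalLength γ ^ 2 ∧
    (projV0 u).2 ^ 2 ≤
      4 * horizontalLength γ ^ 2 * (horizontalLength γ ^ 2 - u.y ^ 2) := by
  obtain ⟨⟨K, hK⟩, hd⟩ := hγ
  have hx : LipschitzOnWith K (fun t => (γ t).x) (Icc 0 1) := by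
    have := LipschitzWith.prod_fst.comp_lipschitzOnWith hK
    rw [one_mul] at this; exact this
  have hyz : LipschitzOnWith K (fun t => (coords (γ t)).2) (Icc 0 1) := by
    have := LipschitzWith.prod_snd.comp_lipschitzOnWith hK
    rw [one_mul] at this; exact this
  have hy : LipschitzOnWith K (fun t => (γ t).y) (Icc 0 1) := by
    have := LipschitzWith.prod_fst.comp_lipschitzOnWith hyz
    rw [one_mul] at this; exact this
  have hz : LipschitzOnWith K (fun t => (γ t).z) (Icc 0 1) := by
    have := LipschitzWith.prod_snd.comp_lipschitzOnWith hyz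
    rw [one_mul] at this; exact this
  have h1 := sq_add_sq_le_length_sq hx hy (right_mem_Icc.2 zero_le_one)
  have h2 := abs_integral_mul_deriv_le hx hy (L := horizontalLength γ) rfl
  rw [← uIcc_of_le zero_le_one] at hx hy hz
  have ax := hx.absolutelyContinuousOnInterval
  have ay := hy.absolutelyContinuousOnInterval
  have az := hz.absolutelyContinuousOnInterval
  have i1 := ax.integral_deriv_mul_eq_sub ay
  have i2 := ay.integral_deriv_eq_sub
  have i3 := az.integral_deriv_eq_sub
  have c1 : IntervalIntegrable (fun t => deriv (fun s => (γ s).x) t * (γ t).y) volume 0 1 :=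
    ax.intervalIntegrable_deriv.mul_continuousOn hy.continuousOn
  have c2 : IntervalIntegrable (fun t => (γ t).x * deriv (fun s => (γ s).y) t) volume 0 1 :=
    ay.intervalIntegrable_deriv.continuousOn_mul hx.continuousOn
  rw [intervalIntegral.integral_add c1 c2] at i1
  have i4 : ∫ t in (0 : ℝ)..1, deriv (fun s => (γ s).z) t =
      ((∫ t in (0 : ℝ)..1, (γ t).x * deriv (fun s => (γ s).y) t) -
        ∫ t in (0 : ℝ)..1, deriv (fun s => (γ s).x) t * (γ t).y) / 2 := by
    rw [← intervalIntegral.integral_sub c2 c1, ← intervalIntegral.integral_div]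
    apply intervalIntegral.integral_congr_ae
    rw [ae_restrict_iff' measurableSet_Icc] at hd
    filter_upwards [hd] with t ht hts
    rw [uIoc_of_le zero_le_one] at hts
    rw [ht (Ioc_subset_Icc_self hts)]; ring
  have i5 : ∫ t in (0 : ℝ)..1, ((γ t).x - (γ 0).x) * deriv (fun s => (γ s).y) t =
      (∫ t in (0 : ℝ)..1, (γ t).x * deriv (fun s => (γ s).y) t) -
        (γ 0).x * ((γ 1).y - (γ 0).y) := by
    rw [← i2, ← intervalIntegral.integral_const_mul, ← intervalIntegral.integral_sub c2
      (ay.intervalIntegrable_deriv.const_mul _)]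
    simp only [sub_mul]
  have ux : u.x = (γ 1).x - (γ 0).x := by rw [hu]; simp; ring
  have uy : u.y = (γ 1).y - (γ 0).y := by rw [hu]; simp; ring
  have uz : u.z = (γ 1).z - (γ 0).z + (-(γ 0).x * (γ 1).y + (γ 0).y * (γ 1).x) / 2 := by
    rw [hu]; simp; ring
  change _ ≤ horizontalLength γ ^ 2 at h1
  rw [← ux, ← uy] at h1
  have hw : (∫ t in (0 : ℝ)..1, ((γ t).x - (γ 0).x) * deriv (fun s => (γ s).y) t) =
      u.z + u.x * u.y / 2 := by
    rw [i5, uz, ux, uy]; linarith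
  rw [hw, ← uy] at h2
  refine ⟨h1, ?_⟩
  have hL := horizontalLength_nonneg γ
  generalize horizontalLength γ = L at *
  obtain ⟨S, hS⟩ : ∃ S, S = √(L ^ 2 - u.y ^ 2) := ⟨_, rfl⟩
  have hS2 : S ^ 2 = L ^ 2 - u.y ^ 2 := by
    rw [hS]; exact Real.sq_sqrt (by nlinarith [sq_nonneg u.x])
  have hS0 : 0 ≤ S := hS ▸ Real.sqrt_nonneg _
  rw [← hS] at h2
  rw [← hS2]
  have hxS : |u.x| ≤ S := abs_le_of_sq_le_sq (by linarith) hS0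
  have hyL : |u.y| ≤ L := abs_le_of_sq_le_sq (by nlinarith [sq_nonneg u.x]) hL
  have hw2 : |(projV0 u).2| ≤ 2 * (S * L) := by
    have e : (projV0 u).2 = (u.z + u.x * u.y / 2) - u.x * u.y := by simp only [projV0]; ring
    rw [e]
    refine (abs_sub _ _).trans ?_
    rw [abs_mul u.x]
    have := mul_le_mul hxS hyL (abs_nonneg _) hS0
    linarith
  rw [← sq_abs]
  calc _ ≤ (2 * (S * L)) ^ 2 := pow_le_pow_left₀ (abs_nonneg _) hw2 2
    _ = _ := by ring

/-- The bounds on the length define a closed set, so they pass from the lengths of curves to their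
infimum. -/
theorem ccDist_bounds (p q : Heis) : 0 ≤ ccDist p q ∧
    (p⁻¹ * q).x ^ 2 + (p⁻¹ * q).y ^ 2 ≤ ccDist p q ^ 2 ∧
    (projV0 (p⁻¹ * q)).2 ^ 2 ≤ 4 * ccDist p q ^ 2 * (ccDist p q ^ 2 - (p⁻¹ * q).y ^ 2) := by
  let T : Set ℝ := {L | 0 ≤ L ∧ (p⁻¹ * q).x ^ 2 + (p⁻¹ * q).y ^ 2 ≤ L ^ 2 ∧
    (projV0 (p⁻¹ * q)).2 ^ 2 ≤ 4 * L ^ 2 * (L ^ 2 - (p⁻¹ * q).y ^ 2)}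
  have hT : IsClosed T := by
    have h1 : Continuous fun L : ℝ => L ^ 2 := by fun_prop
    have h2 : Continuous fun L : ℝ => 4 * L ^ 2 * (L ^ 2 - (p⁻¹ * q).y ^ 2) := by fun_prop
    exact (isClosed_le continuous_const continuous_id).inter
      ((isClosed_le continuous_const h1).inter (isClosed_le continuous_const h2))
  have hsub : horizontalLengths p q ⊆ T := by
    rintro _ ⟨γ, hγ, rfl, rfl, rfl⟩
    exact ⟨horizontalLength_nonneg γ, length_bounds hγ rfl⟩
  exact hT.closure_subset_iff.2 hsub
    (csInf_mem_closure (horizontalLengths_nonempty p q) (bddBelow_horizontalLengths p q))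

/-- Move at constant speed in `y` and add a parabolic detour in `x` to collect the required area.
The coefficient `1` of `|u.y|` is what matters: a Lipschitz constant below `1` can then absorb that
term. -/
theorem ccDist_le (p q : Heis) {u : Heis} (hu : u = p⁻¹ * q) (hy : u.y ≠ 0) :
    ccDist p q ≤ |u.y| + |u.x| + 6 * |u.z / u.y| := by
  -- The detour `k (t - t²)` contributes `u.y k / 6` to the final height.
  obtain ⟨k, hk⟩ : ∃ k, k = 6 * (u.z / u.y) := ⟨_, rfl⟩
  have hk' : u.y * k = 6 * u.z := by rw [hk]; field_simp
  let c1 : ℝ → ℝ := fun t => u.x * t + k * (t - t ^ 2)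
  let c2 : ℝ → ℝ := fun t => u.y * t
  let c3 : ℝ → ℝ := fun t => u.y * k * t ^ 3 / 6
  let γ : ℝ → Heis := fun t => p * ⟨c1 t, c2 t, c3 t⟩
  have h1 : ∀ t, HasDerivAt c1 (u.x + k * (1 - 2 * t)) t := fun t => by
    refine HasDerivAt.congr_deriv (((hasDerivAt_id t).const_mul u.x).add
      (((hasDerivAt_id t).sub ((hasDerivAt_id t).pow 2)).const_mul k)) ?_
    simp
  have h2 : ∀ t, HasDerivAt c2 u.y t := fun t => by
    simpa using (hasDerivAt_id t).const_mul u.y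
  have h3 : ∀ t, HasDerivAt c3 (u.y * k * t ^ 2 / 2) t := fun t => by
    refine HasDerivAt.congr_deriv ((((hasDerivAt_id t).pow 3).const_mul (u.y * k)).div_const 6) ?_
    simp only [id]; push_cast; ring
  have g1 : ∀ t, deriv (fun s => (γ s).x) t = u.x + k * (1 - 2 * t) :=
    fun t => ((h1 t).const_add p.x).deriv
  have g2 : ∀ t, deriv (fun s => (γ s).y) t = u.y := fun t => ((h2 t).const_add p.y).deriv
  have hmem : horizontalLength γ ∈ horizontalLengths p q := by
    refine ⟨γ, ⟨?_, Filter.Eventually.of_forall fun t => ?_⟩, ?_, ?_, rfl⟩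
    · have h : ContDiff ℝ 1 (fun t => coords (γ t)) := by
        simp only [coords, γ, c1, c2, c3, mul_x, mul_y, mul_z]
        fun_prop
      exact h.contDiffOn.exists_lipschitzOnWith (by simp) (convex_Icc 0 1) isCompact_Icc
    · have g3 := (((h3 t).const_add p.z).add
        ((((h2 t).const_mul p.x).sub ((h1 t).const_mul p.y)).div_const 2)).deriv
      rw [g1, g2]
      refine g3.trans ?_
      simp only [γ, c1, c2, mul_x, mul_y]
      ring
    · ext <;> simp [γ, c1, c2, c3]
    · have hq : q = p * u := by rw [hu]; simp
      have : (⟨c1 1, c2 1, c3 1⟩ : Heis) = u := by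
        ext
        · simp [c1]
        · simp [c2]
        · simp [c3, hk']
      rw [hq, ← this]
  refine (csInf_le (bddBelow_horizontalLengths p q) hmem).trans ?_
  have hb := intervalIntegral.norm_integral_le_of_norm_le_const (a := 0) (b := 1)
    (f := fun t => √(deriv (fun s => (γ s).x) t ^ 2 + deriv (fun s => (γ s).y) t ^ 2))
    (C := |u.y| + |u.x| + 6 * |u.z / u.y|) fun t ht => by
      rw [uIoc_of_le zero_le_one] at ht
      rw [g1, g2, Real.norm_eq_abs, abs_of_nonneg (Real.sqrt_nonneg _)]
      have hC : |k| = 6 * |u.z / u.y| := by rw [hk, abs_mul]; norm_num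
      have a1 : |u.x + k * (1 - 2 * t)| ≤ |u.x| + |k| := by
        refine (abs_add_le _ _).trans (add_le_add_right ?_ _)
        rw [abs_mul]
        exact mul_le_of_le_one_right (abs_nonneg _)
          (abs_le.2 ⟨by linarith [ht.2], by linarith [ht.1]⟩)
      rw [← hC]
      refine Real.sqrt_le_iff.2 ⟨by positivity, ?_⟩
      rw [← sq_abs (u.x + _), ← sq_abs u.y]
      nlinarith [abs_nonneg (u.x + k * (1 - 2 * t)), abs_nonneg u.y, abs_nonneg u.x, abs_nonneg k]
  rw [sub_zero, abs_one, mul_one] at hb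
  exact (le_abs_self _).trans hb

/-- The intrinsic Lipschitz condition only depends on the size of `y` against the homogeneous size
of the projection to `V₀`. -/
theorem isIntrinsicLipschitzSet_iff {Γ : Set Heis} : IsIntrinsicLipschitzSet Γ ↔
    ∃ M : ℝ, 0 ≤ M ∧ ∀ p ∈ Γ, ∀ q ∈ Γ,
      (p⁻¹ * q).y ^ 2 ≤ M * ((p⁻¹ * q).x ^ 2 + |(projV0 (p⁻¹ * q)).2|) := by
  constructor
  · rintro ⟨l, ⟨hl0, hl1⟩, h⟩
    obtain ⟨ε, hε⟩ : ∃ ε, ε = 1 - l := ⟨_, rfl⟩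
    have hε0 : 0 < ε := by linarith
    refine ⟨16 / ε ^ 2 + 12 / ε, by positivity, fun p hp q hq => ?_⟩
    obtain ⟨u, hu⟩ : ∃ u, u = p⁻¹ * q := ⟨_, rfl⟩
    have hy : q.y - p.y = u.y := by rw [hu]; simp; ring
    have h1 := h p hp q hq
    rw [hy] at h1
    rw [← hu]
    obtain ⟨w, hw⟩ : ∃ w, w = (projV0 u).2 := ⟨_, rfl⟩
    rw [← hw]
    by_cases hy0 : u.y = 0
    · rw [hy0]; simp; positivity
    have hz : u.z = w + u.x * u.y / 2 := by rw [hw]; simp [projV0]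
    have h2 := ccDist_le p q hu hy0
    have hpos : 0 < |u.y| := abs_pos.2 hy0
    have h3 : |u.z / u.y| ≤ |w| / |u.y| + |u.x| / 2 := by
      have : u.z / u.y = w / u.y + u.x / 2 := by rw [hz]; field_simp
      rw [this]
      refine (abs_add_le _ _).trans ?_
      rw [abs_div, abs_div, abs_two]
    -- Absorb `l |u.y|` on the left; multiplying by `|u.y|` and completing the square then gives a
    -- bound on `u.y ^ 2`.
    have h4 : ε * |u.y| ≤ 4 * |u.x| + 6 * (|w| / |u.y|) := by
      have hd : |u.y| ≤ l * (|u.y| + 4 * |u.x| + 6 * (|w| / |u.y|)) :=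
        h1.trans (mul_le_mul_of_nonneg_left (by linarith) hl0.le)
      have : 0 ≤ 4 * |u.x| + 6 * (|w| / |u.y|) := by positivity
      rw [hε]; nlinarith
    have h5 : ε * |u.y| ^ 2 ≤ 4 * |u.x| * |u.y| + 6 * |w| := by
      have := mul_le_mul_of_nonneg_right h4 hpos.le
      have e : |w| / |u.y| * |u.y| = |w| := div_mul_cancel₀ _ hpos.ne'
      nlinarith
    have h6 : ε ^ 2 * |u.y| ^ 2 ≤ 16 * |u.x| ^ 2 + 12 * ε * |w| := by
      nlinarith [sq_nonneg (ε * |u.y| - 4 * |u.x|), mul_le_mul_of_nonneg_left h5 hε0.le]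
    rw [sq_abs, sq_abs] at h6
    have h7 : u.y ^ 2 ≤ (16 * u.x ^ 2 + 12 * ε * |w|) / ε ^ 2 := by
      rw [le_div_iff₀ (by positivity)]; linarith
    refine h7.trans ?_
    have e : (16 / ε ^ 2 + 12 / ε) * (u.x ^ 2 + |w|) =
      (16 * u.x ^ 2 + 12 * ε * |w|) / ε ^ 2 + (12 / ε * u.x ^ 2 + 16 / ε ^ 2 * |w|) := by
      field_simp; ring
    rw [e]
    have : 0 ≤ 12 / ε * u.x ^ 2 + 16 / ε ^ 2 * |w| := by positivity
    linarith
  · rintro ⟨M, hM, h⟩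
    -- With `s² = d² - y²`, the hypothesis yields `d² ≤ s² + 3 M d s ≤ (3 M + 1) d s`. One more unit
    -- keeps `N > 1` even for `M = 0`, so that the constant `√(1 - N⁻²)` is positive.
    obtain ⟨N, hN⟩ : ∃ N, N = 3 * M + 2 := ⟨_, rfl⟩
    have hN1 : 1 < N := by linarith
    have hNi : N⁻¹ ^ 2 < 1 := by
      rw [inv_pow]; exact inv_lt_one_of_one_lt₀ (by nlinarith)
    have hNp : 0 < N⁻¹ ^ 2 := by positivity
    refine ⟨√(1 - N⁻¹ ^ 2), ⟨Real.sqrt_pos.2 (by linarith), ?_⟩, fun p hp q hq => ?_⟩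
    · rw [Real.sqrt_lt' one_pos]; linarith
    obtain ⟨u, hu⟩ : ∃ u, u = p⁻¹ * q := ⟨_, rfl⟩
    have hy : q.y - p.y = u.y := by rw [hu]; simp; ring
    have h1 := h p hp q hq
    obtain ⟨hd, h2, h3⟩ := ccDist_bounds p q
    rw [← hu] at h1 h2 h3
    rw [hy]
    generalize ccDist p q = d at *
    obtain ⟨s, hs⟩ : ∃ s, s = √(d ^ 2 - u.y ^ 2) := ⟨_, rfl⟩
    have hs2 : s ^ 2 = d ^ 2 - u.y ^ 2 := by
      rw [hs]; exact Real.sq_sqrt (by nlinarith [sq_nonneg u.x])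
    have hs0 : 0 ≤ s := hs ▸ Real.sqrt_nonneg _
    rw [← hs2] at h3
    have hw : |(projV0 u).2| ≤ 2 * d * s :=
      abs_le_of_sq_le_sq (by nlinarith) (by positivity)
    have hsd : s ≤ d := abs_le_of_sq_le_sq' (by nlinarith [sq_nonneg u.y]) hd |>.2
    have h4 : u.y ^ 2 ≤ M * (3 * d * s) := by
      refine h1.trans (mul_le_mul_of_nonneg_left ?_ hM)
      nlinarith
    have h5 : d ≤ N * s := by
      by_contra! hlt
      have hd0 : 0 < d := lt_of_le_of_lt (by positivity) hlt
      have : d * d ≤ N * s * d := by rw [hN]; nlinarith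
      nlinarith
    have h6 : N⁻¹ ^ 2 * d ^ 2 ≤ s ^ 2 := by
      have : N⁻¹ * d ≤ s := by
        rw [inv_mul_le_iff₀ (by linarith)]; exact h5
      rw [← mul_pow]
      exact pow_le_pow_left₀ (by positivity) this 2
    rw [← Real.sqrt_sq hd, ← Real.sqrt_mul (by linarith)]
    apply Real.abs_le_sqrt
    nlinarith

/-! ### Intrinsic gradients and the Dirichlet energy -/

namespace IsIntrinsicGradient

variable {f g θ η : ℝ × ℝ → ℝ}

theorem locallyIntegrable (hf : IsIntrinsicGradient f θ) : LocallyIntegrable θ :=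
  locallyIntegrable_iff.2 fun K hK => by
    have := hK.measure_lt_top (μ := (volume : Measure (ℝ × ℝ)))
    have : IsFiniteMeasure ((volume : Measure (ℝ × ℝ)).restrict K) :=
      ⟨by rwa [Measure.restrict_apply_univ]⟩
    exact (hf.2.1 K hK).integrable le_top

theorem integrableOn (hf : IsIntrinsicGradient f θ) {K : Set (ℝ × ℝ)} (hK : IsCompact K) :
    IntegrableOn θ K :=
  hf.locallyIntegrable.integrableOn_isCompact hK

theorem integrableOn_sq (hf : IsIntrinsicGradient f θ) {K : Set (ℝ × ℝ)} (hK : IsCompact K) :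
    IntegrableOn (fun v => θ v ^ 2) K := by
  have := hK.measure_lt_top (μ := (volume : Measure (ℝ × ℝ)))
  have : IsFiniteMeasure ((volume : Measure (ℝ × ℝ)).restrict K) :=
    ⟨by rwa [Measure.restrict_apply_univ]⟩
  exact ((hf.2.1 K hK).mono_exponent le_top).integrable_sq

theorem integrable_mul (hf : IsIntrinsicGradient f θ) {ψ : ℝ × ℝ → ℝ} (hψ : Continuous ψ)
    (hψc : HasCompactSupport ψ) : Integrable (fun v => θ v * ψ v) := by
  simpa only [smul_eq_mul, mul_comm] using
    hf.locallyIntegrable.integrable_smul_left_of_hasCompactSupport hψ hψc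

theorem integral_mul_eq (hf : IsIntrinsicGradient f θ) (hg : IsIntrinsicGradient g η)
    {ψ : ℝ × ℝ → ℝ} (hψ : ContDiff ℝ 1 ψ) (hψc : HasCompactSupport ψ)
    (h : ∀ v, f v = g v ∨ fderiv ℝ ψ v = 0) : ∫ v, θ v * ψ v = ∫ v, η v * ψ v := by
  rw [hf.2.2 ψ hψ hψc, hg.2.2 ψ hψ hψc]
  congr 1
  ext v
  rcases h v with h | h <;> simp [h]

/-- Functions which agree on an open set have the same intrinsic gradient there. -/
theorem ae_eq_of_eqOn (hf : IsIntrinsicGradient f θ) (hg : IsIntrinsicGradient g η)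
    {O : Set (ℝ × ℝ)} (hO : IsOpen O) (h : EqOn f g O) : ∀ᵐ v, v ∈ O → θ v = η v := by
  have key := hO.ae_eq_zero_of_integral_contDiff_smul_eq_zero (μ := volume)
    (f := fun v => θ v - η v)
    ((hf.locallyIntegrable.sub hg.locallyIntegrable).locallyIntegrableOn O)
    (fun ψ hψ hψc hψO => by
      have hψ1 : ContDiff ℝ 1 ψ := hψ.of_le (by simp)
      have := hf.integral_mul_eq hg hψ1 hψc fun v => by
        by_cases hv : v ∈ tsupport ψ
        · exact Or.inl (h (hψO hv))
        · exact Or.inr (fderiv_of_notMem_tsupport ℝ hv)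
      simp only [smul_eq_mul, mul_comm (ψ _), sub_mul]
      rw [integral_sub (hf.integrable_mul hψ1.continuous hψc)
        (hg.integrable_mul hψ1.continuous hψc), this, sub_self])
  filter_upwards [key] with v hv hvO
  exact sub_eq_zero.1 (hv hvO)

theorem dirichletEnergy_eq (hf : IsIntrinsicGradient f θ) (U : Set (ℝ × ℝ)) :
    dirichletEnergy f U = (1 / 2) * ∫⁻ v in U, ENNReal.ofReal (θ v ^ 2) := by
  refine le_antisymm (iInf₂_le θ hf) (le_iInf₂ fun η hη => le_of_eq ?_)
  congr 1
  apply lintegral_congr_ae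
  filter_upwards [ae_restrict_of_ae (hf.ae_eq_of_eqOn hη isOpen_univ fun _ _ => rfl)] with v hv
  rw [hv (mem_univ v)]

theorem dirichletEnergy_lt_top (hf : IsIntrinsicGradient f θ) {U K : Set (ℝ × ℝ)}
    (hK : IsCompact K) (hU : U ⊆ K) : dirichletEnergy f U < ⊤ := by
  rw [hf.dirichletEnergy_eq]
  refine ENNReal.mul_lt_top (by simp) ((lintegral_mono_set hU).trans_lt ?_)
  exact (hf.integrableOn_sq hK).lintegral_lt_top

theorem ae_eq_compl_closure (hf : IsIntrinsicGradient f θ) (hg : IsIntrinsicGradient g η) :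
    ∀ᵐ v, v ∉ closure {v | f v ≠ g v} → θ v = η v :=
  hf.ae_eq_of_eqOn hg isClosed_closure.isOpen_compl fun v hv => by
    by_contra hne
    exact hv (subset_closure hne)

theorem setIntegral_closure_eq (hf : IsIntrinsicGradient f θ) (hg : IsIntrinsicGradient g η)
    {C : Set (ℝ × ℝ)} (hCdef : C = closure {v | f v ≠ g v}) (hC : IsCompact C) :
    ∫ v in C, θ v = ∫ v in C, η v := by
  have hae := hf.ae_eq_compl_closure hg
  rw [← hCdef] at hae
  obtain ⟨R, hR, hCR⟩ := hC.isBounded.subset_ball_lt 0 0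
  let ψ : ContDiffBump (0 : ℝ × ℝ) := ⟨R, R + 1, hR, by linarith⟩
  have h1 := hf.integral_mul_eq hg (ψ := ψ) ψ.contDiff ψ.hasCompactSupport fun v => by
    by_cases hv : f v = g v
    · exact Or.inl hv
    · right
      have hvC : v ∈ Metric.ball (0 : ℝ × ℝ) R := hCR (hCdef ▸ subset_closure hv)
      rw [(ψ.eventuallyEq_one_of_mem_ball hvC).fderiv_eq]
      exact fderiv_const_apply (1 : ℝ)
  have h2 : ∫ v, (θ v * ψ v - η v * ψ v) = ∫ v in C, (θ v - η v) := by
    rw [← integral_indicator hC.measurableSet]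
    apply integral_congr_ae
    filter_upwards [hae] with v hv
    by_cases hvC : v ∈ C
    · rw [indicator_of_mem hvC, ψ.one_of_mem_closedBall (Metric.ball_subset_closedBall (hCR hvC))]
      ring
    · rw [indicator_of_notMem hvC, hv hvC, sub_self]
  rw [integral_sub (hf.integrable_mul ψ.continuous ψ.hasCompactSupport)
    (hg.integrable_mul ψ.continuous ψ.hasCompactSupport), h1, sub_self,
    integral_sub (hf.integrableOn hC) (hg.integrableOn hC)] at h2
  linarith

/-- The energies of two functions which differ on a relatively compact set compare like the
energies on the closure of that set. -/
theorem dirichletEnergy_le_iff (hf : IsIntrinsicGradient f θ) (hg : IsIntrinsicGradient g η)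
    {C U U' K : Set (ℝ × ℝ)} (hCdef : C = closure {v | f v ≠ g v}) (hC : IsCompact C)
    (hU : C ⊆ U) (hU' : C ⊆ U') (hUU' : U \ C = U' \ C) (hK : IsCompact K) (hUK : U ⊆ K) :
    dirichletEnergy f U ≤ dirichletEnergy g U' ↔
      ∫ v in C, θ v ^ 2 ≤ ∫ v in C, η v ^ 2 := by
  rw [hf.dirichletEnergy_eq, hg.dirichletEnergy_eq,
    ENNReal.mul_le_mul_iff_right (by simp) (by simp),
    ← lintegral_inter_add_sdiff (fun v => ENNReal.ofReal (θ v ^ 2)) U hC.measurableSet,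
    ← lintegral_inter_add_sdiff (fun v => ENNReal.ofReal (η v ^ 2)) U' hC.measurableSet,
    inter_eq_right.2 hU, inter_eq_right.2 hU', ← hUU']
  have e : ∫⁻ v in U \ C, ENNReal.ofReal (θ v ^ 2) = ∫⁻ v in U \ C, ENNReal.ofReal (η v ^ 2) := by
    have hae := hf.ae_eq_compl_closure hg
    rw [← hCdef] at hae
    rw [← Measure.restrict_restrict_of_subset (sdiff_subset_compl U C)]
    apply lintegral_congr_ae
    have : ∀ᵐ v ∂((volume : Measure (ℝ × ℝ)).restrict Cᶜ), θ v = η v := by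
      rw [ae_restrict_iff' hC.measurableSet.compl]
      exact hae
    filter_upwards [ae_restrict_of_ae this] with v hv
    rw [hv]
  have hfin : ∫⁻ v in U \ C, ENNReal.ofReal (η v ^ 2) ≠ ⊤ := by
    rw [← e]
    exact ((lintegral_mono_set (sdiff_subset.trans hUK)).trans_lt
      (hf.integrableOn_sq hK).lintegral_lt_top).ne
  rw [e, ENNReal.add_le_add_iff_right hfin,
    ← ofReal_integral_eq_lintegral_ofReal (hf.integrableOn_sq hC)
      (Filter.Eventually.of_forall fun v => sq_nonneg _),
    ← ofReal_integral_eq_lintegral_ofReal (hg.integrableOn_sq hC)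
      (Filter.Eventually.of_forall fun v => sq_nonneg _),
    ENNReal.ofReal_le_ofReal_iff (integral_nonneg fun v => sq_nonneg _)]

end IsIntrinsicGradient

/-! ### Maps of `ℍ` which send intrinsic graphs to intrinsic graphs -/

theorem isInducing_coords : Topology.IsInducing coords := ⟨rfl⟩

theorem continuous_iff {X : Type*} [TopologicalSpace X] {φ : X → Heis} : Continuous φ ↔
    Continuous (fun t => (φ t).x) ∧ Continuous (fun t => (φ t).y) ∧
      Continuous (fun t => (φ t).z) := by
  rw [isInducing_coords.continuous_iff]
  refine ⟨fun h => ⟨h.fst, h.snd.fst, h.snd.snd⟩, fun h => h.1.prodMk (h.2.1.prodMk h.2.2)⟩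

theorem continuous_coords : Continuous coords := isInducing_coords.continuous

@[fun_prop]
theorem continuous_x : Continuous Heis.x := continuous_coords.fst

@[fun_prop]
theorem continuous_y : Continuous Heis.y := continuous_coords.snd.fst

@[fun_prop]
theorem continuous_z : Continuous Heis.z := continuous_coords.snd.snd

theorem continuous_projV0 : Continuous projV0 := by
  unfold projV0
  fun_prop

theorem ofV0_projV0_mul_expY (p : Heis) : ofV0 (projV0 p) * expY p.y = p := by
  ext <;> simp [ofV0, projV0, expY]

@[simp]
theorem projV0_ofV0_mul_expY (v : ℝ × ℝ) (t : ℝ) : projV0 (ofV0 v * expY t) = v := by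
  ext <;> simp [ofV0, projV0, expY]

theorem y_ofV0_mul_expY (v : ℝ × ℝ) (t : ℝ) : (ofV0 v * expY t).y = t := by
  simp [ofV0, expY]

/-- The data of a map `v Y^t ↦ base v · Y^{β t + lift v}` of `ℍ`, where `base` scales `x` by `α` and
`z` by `α β`, and `lift` is an affine function of `x`. Left translations, stretches and shears are
of this form. -/
@[ext]
structure GraphMap where
  α : ℝ
  β : ℝ
  a : ℝ
  l : ℝ
  m : ℝ
  c : ℝ
  hα : α ≠ 0
  hβ : β ≠ 0

namespace GraphMap

variable (S : GraphMap)

/-- The induced map of `V₀`. -/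
def base (v : ℝ × ℝ) : ℝ × ℝ :=
  (S.α * v.1 + S.a, S.α * S.β * v.2 + (S.c - S.α * (S.l * v.1 + S.m * v.1 ^ 2 / 2)))

/-- The displacement in the direction of `Y`. -/
def lift (x : ℝ) : ℝ := S.l + S.m * x

/-- The map of `ℍ` given by the data. -/
def toFun (p : Heis) : Heis := ofV0 (S.base (projV0 p)) * expY (S.β * p.y + S.lift p.x)

/-- The inverse map. -/
def symm : GraphMap where
  α := S.α⁻¹
  β := S.β⁻¹
  a := -S.a / S.α
  l := -(S.l - S.m * S.a / S.α) / S.β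
  m := -S.m / (S.α * S.β)
  c := (-S.c + S.α * (S.l * (-S.a / S.α) + S.m * (-S.a / S.α) ^ 2 / 2)) / (S.α * S.β)
  hα := inv_ne_zero S.hα
  hβ := inv_ne_zero S.hβ

@[simp]
theorem symm_symm : S.symm.symm = S := by
  have h1 := S.hα
  have h2 := S.hβ
  ext
  · simp [symm]
  · simp [symm]
  · simp only [symm]; field_simp
  · simp only [symm]; field_simp; ring
  · simp only [symm]; field_simp
  · simp only [symm]; field_simp; ring

@[simp]
theorem symm_base_base (v : ℝ × ℝ) : S.symm.base (S.base v) = v := by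
  have h1 := S.hα
  have h2 := S.hβ
  ext
  · simp only [symm, base]; field_simp; ring
  · simp only [symm, base]; field_simp; ring

@[simp]
theorem base_symm_base (v : ℝ × ℝ) : S.base (S.symm.base v) = v := by
  simpa using S.symm.symm_base_base v

theorem base_injective : Function.Injective S.base :=
  Function.LeftInverse.injective S.symm_base_base

theorem base_surjective : Function.Surjective S.base :=
  Function.RightInverse.surjective S.base_symm_base

theorem symm_lift (v : ℝ × ℝ) : S.symm.lift (S.base v).1 = -S.lift v.1 / S.β := by
  have h1 := S.hα
  have h2 := S.hβ
  simp only [symm, base, lift]; field_simp; ring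

theorem projV0_toFun (p : Heis) : projV0 (S.toFun p) = S.base (projV0 p) := by
  simp [toFun]

theorem y_toFun (p : Heis) : (S.toFun p).y = S.β * p.y + S.lift p.x :=
  y_ofV0_mul_expY _ _

theorem x_toFun (p : Heis) : (S.toFun p).x = (S.base (projV0 p)).1 := by
  simp [toFun, ofV0, expY]

theorem toFun_ofV0_mul_expY (v : ℝ × ℝ) (t : ℝ) :
    S.toFun (ofV0 v * expY t) = ofV0 (S.base v) * expY (S.β * t + S.lift v.1) := by
  have : (ofV0 v * expY t).x = v.1 := by simp [ofV0, expY]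
  rw [toFun, projV0_ofV0_mul_expY, y_ofV0_mul_expY, this]

@[simp]
theorem symm_toFun_toFun (p : Heis) : S.symm.toFun (S.toFun p) = p := by
  have h2 := S.hβ
  have hx : (S.base (projV0 p)).1 = (S.toFun p).x := (S.x_toFun p).symm
  rw [toFun, projV0_toFun, symm_base_base, ← hx, symm_lift, y_toFun]
  have : S.symm.β * (S.β * p.y + S.lift p.x) + -S.lift (projV0 p).1 / S.β = p.y := by
    simp only [symm, projV0]; field_simp; ring
  rw [this, ofV0_projV0_mul_expY]

@[simp]
theorem toFun_symm_toFun (p : Heis) : S.toFun (S.symm.toFun p) = p := by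
  simpa using S.symm.symm_toFun_toFun p

theorem continuous_base : Continuous S.base := by
  unfold base
  fun_prop

theorem continuous_toFun : Continuous S.toFun := by
  rw [continuous_iff]
  simp only [toFun, base, lift, projV0, ofV0, expY, mul_x, mul_y, mul_z]
  refine ⟨?_, ?_, ?_⟩ <;> fun_prop

/-- The induced homeomorphism of `V₀`. -/
def baseHomeomorph : (ℝ × ℝ) ≃ₜ (ℝ × ℝ) where
  toFun := S.base
  invFun := S.symm.base
  left_inv := S.symm_base_base
  right_inv := S.base_symm_base
  continuous_toFun := S.continuous_base
  continuous_invFun := S.symm.continuous_base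

/-- The map of `ℍ` as a homeomorphism. -/
def toHomeomorph : Heis ≃ₜ Heis where
  toFun := S.toFun
  invFun := S.symm.toFun
  left_inv := S.symm_toFun_toFun
  right_inv := S.toFun_symm_toFun
  continuous_toFun := S.continuous_toFun
  continuous_invFun := S.symm.continuous_toFun

/-- The function whose intrinsic graph is the image of the graph of `f`. -/
def push (f : ℝ × ℝ → ℝ) (v : ℝ × ℝ) : ℝ :=
  S.β * f (S.symm.base v) + S.lift (S.symm.base v).1

theorem push_base (f : ℝ × ℝ → ℝ) (v : ℝ × ℝ) :
    S.push f (S.base v) = S.β * f v + S.lift v.1 := by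
  simp [push]

theorem symm_push_push (f : ℝ × ℝ → ℝ) : S.symm.push (S.push f) = f := by
  have h2 := S.hβ
  ext v
  rw [push, symm_symm, push_base, symm_lift]
  simp only [symm]; field_simp; ring

theorem push_symm_push (f : ℝ × ℝ → ℝ) : S.push (S.symm.push f) = f := by
  simpa using S.symm.symm_push_push f

theorem image_intrinsicGraph (f : ℝ × ℝ → ℝ) :
    S.toFun '' intrinsicGraph f = intrinsicGraph (S.push f) := by
  ext p
  constructor
  · rintro ⟨_, ⟨v, rfl⟩, rfl⟩
    exact ⟨S.base v, by simp only [push_base, toFun_ofV0_mul_expY]⟩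
  · rintro ⟨v, rfl⟩
    refine ⟨_, ⟨S.symm.base v, rfl⟩, ?_⟩
    simp only [toFun_ofV0_mul_expY, push, base_symm_base]

theorem push_ne_iff (f g : ℝ × ℝ → ℝ) (v : ℝ × ℝ) :
    S.push f (S.base v) ≠ S.push g (S.base v) ↔ f v ≠ g v := by
  simp [push_base, S.hβ]

theorem isIntrinsicLipschitz_push {f : ℝ × ℝ → ℝ} (hf : IsIntrinsicLipschitz f) :
    IsIntrinsicLipschitz (S.push f) := by
  obtain ⟨M, hM, h⟩ := isIntrinsicLipschitzSet_iff.1 hf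
  refine isIntrinsicLipschitzSet_iff.2 ?_
  rw [← S.image_intrinsicGraph]
  have h1 := S.hα
  have h2 := S.hβ
  obtain ⟨N, hN⟩ : ∃ N, N = 2 * S.β ^ 2 * M + 2 * S.m ^ 2 + 2 * S.β ^ 2 * M * |S.m / S.β| := ⟨_, rfl⟩
  have hN0 : 0 ≤ N := by rw [hN]; positivity
  refine ⟨N / S.α ^ 2 + 2 * S.β ^ 2 * M / |S.α * S.β|, by positivity, ?_⟩
  rintro _ ⟨p, hp, rfl⟩ _ ⟨q, hq, rfl⟩
  have h3 := h p hp q hq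
  obtain ⟨u, hu⟩ : ∃ u, u = p⁻¹ * q := ⟨_, rfl⟩
  obtain ⟨u', hu'⟩ : ∃ u', u' = (S.toFun p)⁻¹ * S.toFun q := ⟨_, rfl⟩
  have ex : u'.x = S.α * u.x := by
    rw [hu, hu']; simp [toFun, base, ofV0, expY, projV0]; ring
  have ey : u'.y = S.β * u.y + S.m * u.x := by
    rw [hu, hu']; simp [toFun, ofV0, expY, lift]; ring
  have ew : (projV0 u').2 = S.α * S.β * (projV0 u).2 - S.α * S.m * u.x ^ 2 / 2 := by
    rw [hu, hu']; simp [toFun, base, ofV0, expY, lift, projV0]; ring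
  rw [← hu] at h3
  rw [← hu', ey, ex]
  obtain ⟨w, hw⟩ : ∃ w, w = (projV0 u).2 := ⟨_, rfl⟩
  obtain ⟨w', hw'⟩ : ∃ w', w' = (projV0 u').2 := ⟨_, rfl⟩
  rw [← hw] at h3 ew
  rw [← hw'] at ew ⊢
  have h4 : |w| ≤ |w'| / |S.α * S.β| + |S.m / S.β| * u.x ^ 2 := by
    have : w = w' / (S.α * S.β) + S.m / S.β * u.x ^ 2 / 2 := by rw [ew]; field_simp; ring
    rw [this]
    refine (abs_add_le _ _).trans ?_
    rw [abs_div, abs_div (S.m / S.β * _), abs_mul (S.m / S.β), abs_two, abs_of_nonneg (sq_nonneg u.x)]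
    have : 0 ≤ |S.m / S.β| * u.x ^ 2 := by positivity
    linarith
  have h5 : (S.β * u.y + S.m * u.x) ^ 2 ≤
      N * u.x ^ 2 + 2 * S.β ^ 2 * M * (|w'| / |S.α * S.β|) := by
    have a1 : (S.β * u.y + S.m * u.x) ^ 2 ≤ 2 * S.β ^ 2 * u.y ^ 2 + 2 * S.m ^ 2 * u.x ^ 2 := by
      nlinarith [sq_nonneg (S.β * u.y - S.m * u.x)]
    have a2 := mul_le_mul_of_nonneg_left h3 (show 0 ≤ 2 * S.β ^ 2 by positivity)
    have a3 := mul_le_mul_of_nonneg_left h4 (show 0 ≤ 2 * S.β ^ 2 * M by positivity)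
    rw [hN]
    linarith
  refine h5.trans ?_
  have e : (N / S.α ^ 2 + 2 * S.β ^ 2 * M / |S.α * S.β|) * ((S.α * u.x) ^ 2 + |w'|) =
      N * u.x ^ 2 + 2 * S.β ^ 2 * M * (|w'| / |S.α * S.β|) +
      (N / S.α ^ 2 * |w'| + 2 * S.β ^ 2 * M / |S.α * S.β| * (S.α * u.x) ^ 2) := by
    field_simp; ring
  rw [e]
  have : 0 ≤ N / S.α ^ 2 * |w'| + 2 * S.β ^ 2 * M / |S.α * S.β| * (S.α * u.x) ^ 2 := by positivity
  linarith

/-! #### Change of variables -/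

theorem map_affine_volume {a : ℝ} (ha : a ≠ 0) (b : ℝ) :
    Measure.map (fun t : ℝ => a * t + b) volume = ENNReal.ofReal |a⁻¹| • volume := by
  have : (fun t : ℝ => a * t + b) = (fun t => t + b) ∘ fun t => a * t := rfl
  rw [this, ← Measure.map_map (measurable_add_const b) (measurable_const_mul a),
    Real.map_volume_mul_left ha, Measure.map_smul, map_add_right_eq_self]

theorem exists_map_base_volume : ∃ k : ℝ≥0∞, k ≠ 0 ∧ k ≠ ⊤ ∧
    Measure.map S.base volume = k • volume := by
  have hαβ := mul_ne_zero S.hα S.hβ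
  have h1 : MeasurePreserving (fun x : ℝ => S.α * x + S.a) volume
      (ENNReal.ofReal |S.α⁻¹| • volume) := ⟨by fun_prop, map_affine_volume S.hα S.a⟩
  have h2 := h1.skew_product (μc := volume) (μd := ENNReal.ofReal |(S.α * S.β)⁻¹| • volume)
    (g := fun x z : ℝ => S.α * S.β * z + (S.c - S.α * (S.l * x + S.m * x ^ 2 / 2)))
    (by unfold Function.uncurry; fun_prop)
    (Filter.Eventually.of_forall fun x => map_affine_volume hαβ _)
  refine ⟨ENNReal.ofReal |S.α⁻¹| * ENNReal.ofReal |(S.α * S.β)⁻¹|, ?_, ?_, ?_⟩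
  · refine mul_ne_zero ?_ ?_ <;> rw [Ne, ENNReal.ofReal_eq_zero, not_le, abs_pos]
    · exact inv_ne_zero S.hα
    · exact inv_ne_zero hαβ
  · exact ENNReal.mul_ne_top ENNReal.ofReal_ne_top ENNReal.ofReal_ne_top
  · have h3 := h2.map_eq
    rw [Measure.prod_smul_left, Measure.prod_smul_right, smul_smul] at h3
    exact h3

theorem measurableEmbedding_base : MeasurableEmbedding S.base :=
  S.baseHomeomorph.measurableEmbedding

theorem exists_setIntegral_image_base : ∃ k : ℝ, 0 < k ∧
    ∀ (s : Set (ℝ × ℝ)) (F : ℝ × ℝ → ℝ),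
      ∫ v in s, F (S.base v) = k * ∫ v in S.base '' s, F v := by
  obtain ⟨k, hk0, hkt, hk⟩ := S.exists_map_base_volume
  refine ⟨k.toReal, ENNReal.toReal_pos hk0 hkt, fun s F => ?_⟩
  have h := S.measurableEmbedding_base.setIntegral_map (μ := volume) F (S.base '' s)
  rw [hk, Measure.restrict_smul, integral_smul_measure, preimage_image_eq _
    S.base_injective] at h
  rw [← h, smul_eq_mul]

theorem exists_integral_base : ∃ k : ℝ, 0 < k ∧
    ∀ F : ℝ × ℝ → ℝ, ∫ v, F (S.base v) = k * ∫ v, F v := by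
  obtain ⟨k, hk, h⟩ := S.exists_setIntegral_image_base
  refine ⟨k, hk, fun F => ?_⟩
  have := h univ F
  rwa [image_univ, S.base_surjective.range_eq, setIntegral_univ, setIntegral_univ] at this

/-- The intrinsic gradient of `S.push f` when `θ` is the intrinsic gradient of `f`. -/
def pushGradient (θ : ℝ × ℝ → ℝ) (v : ℝ × ℝ) : ℝ := (S.β * θ (S.symm.base v) + S.m) / S.α

theorem fderiv_comp_base {ψ : ℝ × ℝ → ℝ} (hψ : Differentiable ℝ ψ) (v : ℝ × ℝ) :
    fderiv ℝ (ψ ∘ S.base) v (1, 0) = S.α * fderiv ℝ ψ (S.base v) (1, 0) -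
        S.α * S.lift v.1 * fderiv ℝ ψ (S.base v) (0, 1) ∧
      fderiv ℝ (ψ ∘ S.base) v (0, 1) = S.α * S.β * fderiv ℝ ψ (S.base v) (0, 1) := by
  have e : ∀ x y : ℝ, fderiv ℝ ψ (S.base v) (x, y) =
      x * fderiv ℝ ψ (S.base v) (1, 0) + y * fderiv ℝ ψ (S.base v) (0, 1) := fun x y => by
    have : ((x, y) : ℝ × ℝ) = x • (1, 0) + y • (0, 1) := by simp
    rw [this, map_add, map_smul, map_smul, smul_eq_mul, smul_eq_mul]
  have h1 : HasFDerivAt (fun v : ℝ × ℝ => v.1) (ContinuousLinearMap.fst ℝ ℝ ℝ) v := hasFDerivAt_fst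
  have h2 : HasFDerivAt (fun v : ℝ × ℝ => v.2) (ContinuousLinearMap.snd ℝ ℝ ℝ) v := hasFDerivAt_snd
  have h3 := ((h1.const_mul S.α).add_const S.a).prodMk ((h2.const_mul (S.α * S.β)).add
    ((((h1.const_mul S.l).add (((h1.pow 2).const_mul S.m).mul_const 2⁻¹)).const_mul S.α).const_sub S.c))
  have h4 : HasFDerivAt S.base _ v := h3
  rw [((hψ (S.base v)).hasFDerivAt.comp v h4).fderiv]
  constructor
  · rw [ContinuousLinearMap.comp_apply, ContinuousLinearMap.prod_apply, e]
    simp [lift]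
    ring
  · rw [ContinuousLinearMap.comp_apply, ContinuousLinearMap.prod_apply, e]
    simp

theorem contDiff_base : ContDiff ℝ 1 S.base := by
  unfold base
  fun_prop

theorem integral_lift_mul_fderiv {φ : ℝ × ℝ → ℝ} (hφ : ContDiff ℝ 1 φ)
    (hφc : HasCompactSupport φ) :
    ∫ v : ℝ × ℝ, S.lift v.1 * fderiv ℝ φ v (1, 0) = -∫ v, S.m * φ v ∧
      ∫ v : ℝ × ℝ, S.lift v.1 ^ 2 * fderiv ℝ φ v (0, 1) = 0 := by
  have hd : ∀ w, Continuous fun v => fderiv ℝ φ v w := fun w =>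
    (hφ.continuous_fderiv (by simp)).clm_apply continuous_const
  have hc : ∀ w, HasCompactSupport fun v => fderiv ℝ φ v w := fun w =>
    hφc.fderiv_apply ℝ w
  have h1 : ∀ v, HasFDerivAt (fun v : ℝ × ℝ => S.lift v.1)
      (S.m • ContinuousLinearMap.fst ℝ ℝ ℝ) v := fun v =>
    (hasFDerivAt_fst.const_mul S.m).const_add S.l
  have hl : Continuous fun v : ℝ × ℝ => S.lift v.1 := by unfold lift; fun_prop
  constructor
  · have := integral_mul_fderiv_eq_neg_fderiv_mul_of_integrable (μ := volume)
      (f := fun v : ℝ × ℝ => S.lift v.1) (g := φ) (v := (1, 0))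
      (by simp only [(h1 _).fderiv]
          exact (continuous_const.mul hφ.continuous).integrable_of_hasCompactSupport hφc.mul_left)
      ((hl.mul (hd _)).integrable_of_hasCompactSupport (hc _).mul_left)
      ((hl.mul hφ.continuous).integrable_of_hasCompactSupport hφc.mul_left)
      (fun v _ => (h1 v).differentiableAt)
      (fun v _ => hφ.differentiable (by simp) v)
    rw [this]
    simp only [(h1 _).fderiv]
    simp
  · have h2 := fun v => (h1 v).pow 2
    have := integral_mul_fderiv_eq_neg_fderiv_mul_of_integrable (μ := volume)
      (f := fun v : ℝ × ℝ => S.lift v.1 ^ 2) (g := φ) (v := (0, 1))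
      (by simp only [(h2 _).fderiv]
          simp)
      (((hl.pow 2).mul (hd _)).integrable_of_hasCompactSupport (hc _).mul_left)
      (((hl.pow 2).mul hφ.continuous).integrable_of_hasCompactSupport hφc.mul_left)
      (fun v _ => (h2 v).differentiableAt)
      (fun v _ => hφ.differentiable (by simp) v)
    rw [this]
    simp only [(h2 _).fderiv]
    simp

theorem memLp_pushGradient {θ : ℝ × ℝ → ℝ}
    (hθ : ∀ K : Set (ℝ × ℝ), IsCompact K → MemLp θ ∞ (volume.restrict K)) {K : Set (ℝ × ℝ)}
    (hK : IsCompact K) : MemLp (S.pushGradient θ) ∞ (volume.restrict K) := by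
  have hfin : IsFiniteMeasure ((volume : Measure (ℝ × ℝ)).restrict K) :=
    ⟨by rw [Measure.restrict_apply_univ]; exact hK.measure_lt_top⟩
  obtain ⟨k, hk0, hkt, hk⟩ := S.symm.exists_map_base_volume
  have h1 : MemLp (θ ∘ S.symm.base) ∞ (volume.restrict K) := by
    rw [← S.symm.measurableEmbedding_base.memLp_map_measure_iff]
    have h2 := S.symm.measurableEmbedding_base.restrict_map volume (S.symm.base '' K)
    rw [preimage_image_eq _ S.symm.base_injective, hk] at h2
    rw [← h2, Measure.restrict_smul]
    exact (hθ _ (hK.image S.symm.continuous_base)).smul_measure hkt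
  have h3 := ((h1.const_mul S.β).add (memLp_const S.m)).mul_const S.α⁻¹
  exact h3

theorem isIntrinsicGradient_push {f θ : ℝ × ℝ → ℝ} (hf : IsIntrinsicGradient f θ) :
    IsIntrinsicGradient (S.push f) (S.pushGradient θ) := by
  refine ⟨?_, fun K hK => S.memLp_pushGradient hf.2.1 hK, fun ψ hψ hψc => ?_⟩
  · have := hf.1
    have := S.symm.continuous_base
    unfold push lift
    fun_prop
  have h1 := S.hα
  have h2 := S.hβ
  obtain ⟨k, hk, hS⟩ := S.exists_integral_base
  apply mul_left_cancel₀ hk.ne'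
  rw [← hS, ← hS]
  obtain ⟨φ, hφdef⟩ : ∃ φ, φ = ψ ∘ S.base := ⟨_, rfl⟩
  have hφ : ContDiff ℝ 1 φ := hφdef ▸ hψ.comp S.contDiff_base
  have hφc : HasCompactSupport φ := hφdef ▸ hψc.comp_homeomorph S.baseHomeomorph
  have hd : ∀ w, Continuous fun v => fderiv ℝ φ v w := fun w =>
    (hφ.continuous_fderiv (by simp)).clm_apply continuous_const
  have hc : ∀ w, HasCompactSupport fun v => fderiv ℝ φ v w := fun w => hφc.fderiv_apply ℝ w
  have hl : Continuous fun v : ℝ × ℝ => S.lift v.1 := by unfold lift; fun_prop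
  obtain ⟨e1, e2⟩ := S.integral_lift_mul_fderiv hφ hφc
  have i1 := hf.integrable_mul hφ.continuous hφc
  have i2 := hφ.continuous.integrable_of_hasCompactSupport (μ := volume) hφc
  have i3 : Integrable fun v => -f v * fderiv ℝ φ v (1, 0) + f v ^ 2 / 2 * fderiv ℝ φ v (0, 1) :=
    ((hf.1.neg.mul (hd _)).integrable_of_hasCompactSupport (hc _).mul_left).add
      ((((hf.1.pow 2).div_const 2).mul (hd _)).integrable_of_hasCompactSupport (hc _).mul_left)
  have i4 : Integrable fun v : ℝ × ℝ => S.lift v.1 * fderiv ℝ φ v (1, 0) :=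
    (hl.mul (hd (1, 0))).integrable_of_hasCompactSupport (hc _).mul_left
  have i5 : Integrable fun v : ℝ × ℝ => S.lift v.1 ^ 2 * fderiv ℝ φ v (0, 1) :=
    ((hl.pow 2).mul (hd (0, 1))).integrable_of_hasCompactSupport (hc _).mul_left
  have i6 : Integrable fun v =>
      S.β / S.α * (-f v * fderiv ℝ φ v (1, 0) + f v ^ 2 / 2 * fderiv ℝ φ v (0, 1)) -
        S.α⁻¹ * (S.lift v.1 * fderiv ℝ φ v (1, 0)) := (i3.const_mul _).sub (i4.const_mul _)
  have L : ∫ v, S.pushGradient θ (S.base v) * ψ (S.base v) =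
      (S.β / S.α) * (∫ v, θ v * φ v) + S.α⁻¹ * ∫ v, S.m * φ v := by
    rw [← integral_const_mul, ← integral_const_mul,
      ← integral_add (i1.const_mul _) ((i2.const_mul _).const_mul _)]
    congr 1
    ext v
    simp only [pushGradient, symm_base_base, hφdef, Function.comp_apply]
    field_simp
  have R : ∫ v, (-S.push f (S.base v) * fderiv ℝ ψ (S.base v) (1, 0) +
        S.push f (S.base v) ^ 2 / 2 * fderiv ℝ ψ (S.base v) (0, 1)) =
      (S.β / S.α) * (∫ v, (-f v * fderiv ℝ φ v (1, 0) + f v ^ 2 / 2 * fderiv ℝ φ v (0, 1))) -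
        S.α⁻¹ * (∫ v : ℝ × ℝ, S.lift v.1 * fderiv ℝ φ v (1, 0)) -
        (2 * S.α * S.β)⁻¹ * ∫ v : ℝ × ℝ, S.lift v.1 ^ 2 * fderiv ℝ φ v (0, 1) := by
    rw [← integral_const_mul, ← integral_const_mul, ← integral_const_mul,
      ← integral_sub (i3.const_mul _) (i4.const_mul _),
      ← integral_sub i6 (i5.const_mul _)]
    congr 1
    ext v
    obtain ⟨d1, d2⟩ := S.fderiv_comp_base (hψ.differentiable (by simp)) v
    rw [hφdef, d1, d2, push_base]
    field_simp
    ring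
  rw [L, R, e1, e2, hf.2.2 φ hφ hφc]
  ring

end GraphMap

/-! ### Bounded sets -/

theorem exists_isCompact_ccBall_subset (p : Heis) (r : ℝ) :
    ∃ K : Set Heis, IsCompact K ∧ ccBall p r ⊆ K := by
  let φ : ℝ × ℝ × ℝ → Heis := fun c => p * ⟨c.1, c.2.1, c.2.2 + c.1 * c.2.1 / 2⟩
  have hφ : Continuous φ := by
    rw [continuous_iff]
    simp only [φ, mul_x, mul_y, mul_z]
    refine ⟨?_, ?_, ?_⟩ <;> fun_prop
  refine ⟨φ '' (Icc (-r) r ×ˢ Icc (-r) r ×ˢ Icc (-(2 * r ^ 2)) (2 * r ^ 2)),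
    (isCompact_Icc.prod (isCompact_Icc.prod isCompact_Icc)).image hφ, fun q hq => ?_⟩
  obtain ⟨h0, h1, h2⟩ := ccDist_bounds p q
  have hr : ccDist p q < r := hq
  obtain ⟨u, hu⟩ : ∃ u, u = p⁻¹ * q := ⟨_, rfl⟩
  rw [← hu] at h1 h2
  generalize ccDist p q = d at *
  have hr0 : 0 ≤ r := h0.trans hr.le
  refine ⟨(u.x, u.y, (projV0 u).2), ⟨abs_le.1 ?_, abs_le.1 ?_, abs_le.1 ?_⟩, ?_⟩
  · exact abs_le_of_sq_le_sq (by nlinarith [sq_nonneg u.y]) hr0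
  · exact abs_le_of_sq_le_sq (by nlinarith [sq_nonneg u.x]) hr0
  · have h3 : |(projV0 u).2| ≤ 2 * d ^ 2 :=
      abs_le_of_sq_le_sq (by nlinarith [mul_nonneg (sq_nonneg d) (sq_nonneg u.y)]) (by positivity)
    exact h3.trans (by nlinarith)
  · have e : (⟨u.x, u.y, (projV0 u).2 + u.x * u.y / 2⟩ : Heis) = u := by
      ext <;> simp [projV0]
    simp only [φ]
    rw [e, hu, mul_inv_cancel_left]

theorem exists_subset_ccBall {K : Set Heis} (hK : IsCompact K) :
    ∃ (p : Heis) (r : ℝ), 0 < r ∧ K ⊆ ccBall p r := by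
  obtain ⟨N, hN⟩ := hK.exists_bound_of_continuousOn continuous_y.continuousOn
  let p : Heis := ⟨0, -(N + 1), 0⟩
  let φ : Heis → ℝ := fun q => |(p⁻¹ * q).y| + |(p⁻¹ * q).x| + 6 * |(p⁻¹ * q).z|
  have hφ : Continuous φ := by
    simp only [φ, mul_x, mul_y, mul_z]
    fun_prop
  obtain ⟨R, hR⟩ := hK.exists_bound_of_continuousOn hφ.continuousOn
  refine ⟨p, |R| + 1, by positivity, fun q hq => ?_⟩
  have hy : 1 ≤ (p⁻¹ * q).y := by
    have := (abs_le.1 (hN q hq)).1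
    simp only [mul_y, inv_y, p]
    linarith
  have h1 := ccDist_le p q rfl (by linarith : (p⁻¹ * q).y ≠ 0)
  have h2 : |(p⁻¹ * q).z / (p⁻¹ * q).y| ≤ |(p⁻¹ * q).z| := by
    rw [abs_div]
    exact div_le_self (abs_nonneg _) (hy.trans (le_abs_self _))
  have h3 : φ q ≤ |R| := (le_abs_self _).trans ((hR q hq).trans (le_abs_self R))
  change ccDist p q < _
  simp only [φ] at h3
  linarith

theorem projV0_image_inter_intrinsicGraph (f : ℝ × ℝ → ℝ) (V : Set Heis) :
    projV0 '' (V ∩ intrinsicGraph f) = {v | ofV0 v * expY (f v) ∈ V} := by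
  ext v
  constructor
  · rintro ⟨_, ⟨hp, w, rfl⟩, rfl⟩
    simpa using hp
  · exact fun hv => ⟨_, ⟨hv, v, rfl⟩, by simp⟩

/-! ### The region between two graphs -/

/-- The closed fibres between the graphs of `f` and `g`, over the points where `f` and `g` differ. -/
def between (f g : ℝ × ℝ → ℝ) : Set Heis :=
  {p | f (projV0 p) ≠ g (projV0 p) ∧ p.y ∈ uIcc (f (projV0 p)) (g (projV0 p))}

theorem mem_epigraph_intrinsicGraph {f : ℝ × ℝ → ℝ} {p : Heis} :
    p ∈ epigraph (intrinsicGraph f) ↔ f (projV0 p) ≤ p.y := by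
  constructor
  · rintro ⟨_, ⟨v, rfl⟩, t, ht, rfl⟩
    have e : ofV0 v * expY (f v) * expY t = ofV0 v * expY (f v + t) := by
      rw [mul_assoc]
      congr 1
      ext <;> simp [expY]
    rw [e, projV0_ofV0_mul_expY, y_ofV0_mul_expY]
    linarith
  · intro h
    refine ⟨_, ⟨projV0 p, rfl⟩, p.y - f (projV0 p), sub_nonneg.2 h, ?_⟩
    ext <;> simp [ofV0, projV0, expY]
    ring

theorem continuous_ofV0_mul_expY {X : Type*} [TopologicalSpace X] {v : X → ℝ × ℝ} {t : X → ℝ}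
    (hv : Continuous v) (ht : Continuous t) : Continuous fun s => ofV0 (v s) * expY (t s) := by
  rw [continuous_iff]
  simp only [ofV0, expY, mul_x, mul_y, mul_z]
  refine ⟨?_, ?_, ?_⟩ <;> fun_prop

theorem closure_symmDiff_epigraph (f g : ℝ × ℝ → ℝ) :
    closure (epigraph (intrinsicGraph f) ∆ epigraph (intrinsicGraph g)) =
      closure (between f g) := by
  have hmem : ∀ p, p ∈ epigraph (intrinsicGraph f) ∆ epigraph (intrinsicGraph g) ↔
      (f (projV0 p) ≤ p.y ∧ p.y < g (projV0 p)) ∨ (g (projV0 p) ≤ p.y ∧ p.y < f (projV0 p)) := by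
    intro p
    rw [mem_symmDiff, mem_epigraph_intrinsicGraph, mem_epigraph_intrinsicGraph, not_le, not_le]
  refine subset_antisymm (closure_mono fun p hp => ?_) (closure_minimal (fun p hp => ?_)
    isClosed_closure)
  · rcases (hmem p).1 hp with ⟨h1, h2⟩ | ⟨h1, h2⟩
    · exact ⟨(h1.trans_lt h2).ne, mem_uIcc.2 (Or.inl ⟨h1, h2.le⟩)⟩
    · exact ⟨(h1.trans_lt h2).ne', mem_uIcc.2 (Or.inr ⟨h1, h2.le⟩)⟩
  · obtain ⟨hne, hy⟩ := hp
    rw [← ofV0_projV0_mul_expY p]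
    have hc : Continuous fun t => ofV0 (projV0 p) * expY t :=
      continuous_ofV0_mul_expY continuous_const continuous_id
    rcases lt_or_gt_of_ne hne with hlt | hlt
    · rw [uIcc_of_le hlt.le, ← closure_Ico hlt.ne] at hy
      refine map_mem_closure (f := fun t => ofV0 (projV0 p) * expY t) hc hy
        fun t ht => (hmem _).2 (Or.inl ?_)
      rwa [projV0_ofV0_mul_expY, y_ofV0_mul_expY]
    · rw [uIcc_of_ge hlt.le, ← closure_Ico hlt.ne] at hy
      refine map_mem_closure (f := fun t => ofV0 (projV0 p) * expY t) hc hy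
        fun t ht => (hmem _).2 (Or.inr ?_)
      rwa [projV0_ofV0_mul_expY, y_ofV0_mul_expY]

theorem isCompact_closure_ne {f g : ℝ × ℝ → ℝ} (hK : IsCompact (closure (between f g))) :
    IsCompact (closure {v | f v ≠ g v}) := by
  refine (hK.image continuous_projV0).closure_of_subset fun v hv => ?_
  exact ⟨ofV0 v * expY (f v), subset_closure (by
    change f (projV0 _) ≠ g (projV0 _) ∧ _ ∈ uIcc _ _
    rw [projV0_ofV0_mul_expY, y_ofV0_mul_expY]
    exact ⟨hv, left_mem_uIcc⟩), by simp⟩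

theorem ofV0_mul_expY_mem_closure_between {f g : ℝ × ℝ → ℝ} (hf : Continuous f) {v : ℝ × ℝ}
    (hv : v ∈ closure {v | f v ≠ g v}) : ofV0 v * expY (f v) ∈ closure (between f g) := by
  refine map_mem_closure (f := fun w => ofV0 w * expY (f w))
    (continuous_ofV0_mul_expY continuous_id hf) hv fun w hw => ?_
  change f (projV0 _) ≠ g (projV0 _) ∧ _ ∈ uIcc _ _
  rw [projV0_ofV0_mul_expY, y_ofV0_mul_expY]
  exact ⟨hw, left_mem_uIcc⟩

theorem between_comm (f g : ℝ × ℝ → ℝ) : between f g = between g f := by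
  ext p
  simp only [between, mem_ofPred_eq, uIcc_comm (f _), ne_comm (a := f _)]

theorem graphEnergy_le_iff {f g θ η : ℝ × ℝ → ℝ} (hf : IsIntrinsicGradient f θ)
    (hg : IsIntrinsicGradient g η) {V K : Set Heis} (hK : IsCompact K) (hVK : V ⊆ K)
    (hD : IsCompact (closure (between f g))) (hDV : closure (between f g) ⊆ V) :
    graphEnergy f V ≤ graphEnergy g V ↔
      ∫ v in closure {v | f v ≠ g v}, θ v ^ 2 ≤ ∫ v in closure {v | f v ≠ g v}, η v ^ 2 := by
  unfold graphEnergy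
  refine hf.dirichletEnergy_le_iff hg rfl (isCompact_closure_ne hD) ?_ ?_ ?_
    (hK.image continuous_projV0) (image_mono (inter_subset_left.trans hVK))
  · rw [projV0_image_inter_intrinsicGraph]
    exact fun v hv => hDV (ofV0_mul_expY_mem_closure_between hf.1 hv)
  · rw [projV0_image_inter_intrinsicGraph]
    intro v hv
    simp only [ne_comm (a := f _)] at hv
    rw [between_comm] at hDV
    exact hDV (ofV0_mul_expY_mem_closure_between hg.1 hv)
  · rw [projV0_image_inter_intrinsicGraph, projV0_image_inter_intrinsicGraph]
    ext v
    refine and_congr_left fun hv => ?_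
    have : f v = g v := by
      by_contra hne
      exact hv (subset_closure hne)
    simp only [mem_ofPred_eq, this]

theorem graphEnergy_lt_top {f θ : ℝ × ℝ → ℝ} (hf : IsIntrinsicGradient f θ) {V K : Set Heis}
    (hK : IsCompact K) (hVK : V ⊆ K) : graphEnergy f V < ⊤ :=
  hf.dirichletEnergy_lt_top (hK.image continuous_projV0)
    (image_mono (inter_subset_left.trans hVK))

theorem exists_isIntrinsicGradient {f : ℝ × ℝ → ℝ} {V : Set Heis} (h : graphEnergy f V < ⊤) :
    ∃ θ, IsIntrinsicGradient f θ := by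
  obtain ⟨θ, hθ⟩ := iInf_lt_iff.1 h
  exact ⟨θ, (iInf_lt_iff.1 hθ).1⟩

namespace GraphMap

variable (S : GraphMap)

theorem image_between_subset (f g : ℝ × ℝ → ℝ) :
    S.toFun '' between f g ⊆ between (S.push f) (S.push g) := by
  rintro _ ⟨p, ⟨hne, hy⟩, rfl⟩
  refine ⟨?_, ?_⟩
  · rwa [projV0_toFun, push_ne_iff]
  · rw [projV0_toFun, push_base, push_base, y_toFun]
    change _ ∈ uIcc (S.β * _ + S.lift p.x) (S.β * _ + S.lift p.x)
    rw [mem_uIcc] at hy ⊢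
    rcases lt_or_gt_of_ne S.hβ with hβ | hβ
    · rcases hy with ⟨h1, h2⟩ | ⟨h1, h2⟩
      · exact Or.inr ⟨by nlinarith, by nlinarith⟩
      · exact Or.inl ⟨by nlinarith, by nlinarith⟩
    · rcases hy with ⟨h1, h2⟩ | ⟨h1, h2⟩
      · exact Or.inl ⟨by nlinarith, by nlinarith⟩
      · exact Or.inr ⟨by nlinarith, by nlinarith⟩

theorem image_between (f g : ℝ × ℝ → ℝ) :
    S.toFun '' between f g = between (S.push f) (S.push g) := by
  refine subset_antisymm (S.image_between_subset f g) fun p hp => ?_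
  have := S.symm.image_between_subset _ _ (mem_image_of_mem _ hp)
  rw [symm_push_push, symm_push_push] at this
  exact ⟨_, this, S.toFun_symm_toFun p⟩

theorem image_closure_between (f g : ℝ × ℝ → ℝ) :
    S.toFun '' closure (between f g) = closure (between (S.push f) (S.push g)) := by
  rw [← S.image_between]
  exact S.toHomeomorph.image_closure _

theorem image_closure_ne (f g : ℝ × ℝ → ℝ) :
    S.base '' closure {v | f v ≠ g v} = closure {v | S.push f v ≠ S.push g v} := by
  refine (S.baseHomeomorph.image_closure _).trans (congrArg closure ?_)
  ext v
  constructor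
  · rintro ⟨w, hw, rfl⟩
    exact (S.push_ne_iff f g w).2 hw
  · intro hv
    refine ⟨S.symm.base v, ?_, S.base_symm_base v⟩
    rw [mem_ofPred_eq, ← S.push_ne_iff, S.base_symm_base]
    exact hv

theorem setIntegral_pushGradient_le_iff {f g θ η : ℝ × ℝ → ℝ} (hf : IsIntrinsicGradient f θ)
    (hg : IsIntrinsicGradient g η) {C : Set (ℝ × ℝ)} (hCdef : C = closure {v | f v ≠ g v})
    (hC : IsCompact C) :
    ∫ v in S.base '' C, S.pushGradient θ v ^ 2 ≤ ∫ v in S.base '' C, S.pushGradient η v ^ 2 ↔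
      ∫ v in C, θ v ^ 2 ≤ ∫ v in C, η v ^ 2 := by
  obtain ⟨k, hk, h⟩ := S.exists_setIntegral_image_base
  have hα := S.hα
  have hβ := S.hβ
  have key : ∀ {f θ : ℝ × ℝ → ℝ}, IsIntrinsicGradient f θ →
      ∫ v in C, S.pushGradient θ (S.base v) ^ 2 = S.β ^ 2 / S.α ^ 2 * (∫ v in C, θ v ^ 2) +
        2 * S.β * S.m / S.α ^ 2 * (∫ v in C, θ v) + ∫ _ in C, S.m ^ 2 / S.α ^ 2 := by
    intro f θ hf
    have i1 := (hf.integrableOn_sq hC).const_mul (S.β ^ 2 / S.α ^ 2)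
    have i2 := (hf.integrableOn hC).const_mul (2 * S.β * S.m / S.α ^ 2)
    have i3 : IntegrableOn (fun _ : ℝ × ℝ => S.m ^ 2 / S.α ^ 2) C :=
      integrableOn_const hC.measure_lt_top.ne
    have i4 : IntegrableOn (fun v => S.β ^ 2 / S.α ^ 2 * θ v ^ 2 +
      2 * S.β * S.m / S.α ^ 2 * θ v) C := i1.add i2
    rw [← integral_const_mul, ← integral_const_mul, ← integral_add i1 i2, ← integral_add i4 i3]
    congr 1
    ext v
    simp only [pushGradient, symm_base_base]
    field_simp
    ring
  rw [← mul_le_mul_iff_right₀ hk, ← h C fun v => S.pushGradient θ v ^ 2,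
    ← h C fun v => S.pushGradient η v ^ 2, key hf, key hg, hf.setIntegral_closure_eq hg hCdef hC,
    add_le_add_iff_right, add_le_add_iff_right, mul_le_mul_iff_right₀ (by positivity)]

theorem isEnergyMinimizingOn_image {Γ W : Set Heis} (hΓ : IsEnergyMinimizingOn Γ W) :
    IsEnergyMinimizingOn (S.toFun '' Γ) (S.toFun '' W) := by
  obtain ⟨f, hf, rfl, hmin⟩ := hΓ
  refine ⟨S.push f, S.isIntrinsicLipschitz_push hf, S.image_intrinsicGraph f,
    fun p r hr g' hg' hcc => ?_⟩
  obtain ⟨g, hgdef⟩ : ∃ g, g = S.symm.push g' := ⟨_, rfl⟩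
  have hg : IsIntrinsicLipschitz g := hgdef ▸ S.symm.isIntrinsicLipschitz_push hg'
  obtain rfl : g' = S.push g := by rw [hgdef, push_symm_push]
  by_cases hfin : graphEnergy (S.push g) (S.toFun '' W ∩ ccBall p r) = ⊤
  · rw [hfin]; exact le_top
  obtain ⟨η', hη'⟩ := exists_isIntrinsicGradient (lt_top_iff_ne_top.2 hfin)
  obtain ⟨η, hη⟩ : ∃ η, IsIntrinsicGradient g η := by
    have := S.symm.isIntrinsicGradient_push hη'
    rw [symm_push_push] at this
    exact ⟨_, this⟩
  obtain ⟨B, hB, hpB⟩ := exists_isCompact_ccBall_subset p r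
  obtain ⟨p₀, r₀, hr₀, hBr⟩ := exists_subset_ccBall (hB.image S.symm.continuous_toFun)
  obtain ⟨B₀, hB₀, hpB₀⟩ := exists_isCompact_ccBall_subset p₀ r₀
  unfold CompactlyContained at hcc hmin
  rw [S.image_intrinsicGraph, closure_symmDiff_epigraph, ← image_closure_between] at hcc
  obtain ⟨hc1, hc2⟩ := hcc
  have hD : IsCompact (closure (between f g)) := S.toHomeomorph.isCompact_image.1 hc1
  have hDV : closure (between f g) ⊆ W ∩ ccBall p₀ r₀ := fun u hu => by
    obtain ⟨⟨w, hw, hwu⟩, hu2⟩ := hc2 (mem_image_of_mem _ hu)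
    obtain rfl : w = u := S.toHomeomorph.injective hwu
    refine ⟨hw, hBr ⟨_, hpB hu2, S.symm_toFun_toFun w⟩⟩
  have hle := hmin p₀ r₀ hr₀ g hg (by rw [closure_symmDiff_epigraph]; exact ⟨hD, hDV⟩)
  have hsub : W ∩ ccBall p₀ r₀ ⊆ B₀ := inter_subset_right.trans hpB₀
  obtain ⟨θ, hθ⟩ := exists_isIntrinsicGradient
    (hle.trans_lt (graphEnergy_lt_top hη hB₀ hsub))
  rw [graphEnergy_le_iff hθ hη hB₀ hsub hD hDV] at hle
  rw [image_closure_between] at hc1 hc2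
  rw [graphEnergy_le_iff (S.isIntrinsicGradient_push hθ) (S.isIntrinsicGradient_push hη) hB
    (inter_subset_right.trans hpB) hc1 hc2, ← image_closure_ne,
    S.setIntegral_pushGradient_le_iff hθ hη rfl (isCompact_closure_ne hD)]
  exact hle

/-- Left translations as graph maps. -/
def ofMulLeft (h : Heis) : GraphMap where
  α := 1
  β := 1
  a := h.x
  l := h.y
  m := 0
  c := h.z - h.x * h.y / 2
  hα := one_ne_zero
  hβ := one_ne_zero

theorem ofMulLeft_toFun (h : Heis) : (ofMulLeft h).toFun = fun p => h * p := by
  ext p <;> simp [ofMulLeft, toFun, base, lift, projV0, ofV0, expY] <;> ring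

/-- Stretches as graph maps. -/
def ofStretch {a b : ℝ} (ha : a ≠ 0) (hb : b ≠ 0) : GraphMap where
  α := a
  β := b
  a := 0
  l := 0
  m := 0
  c := 0
  hα := ha
  hβ := hb

theorem ofStretch_toFun {a b : ℝ} (ha : a ≠ 0) (hb : b ≠ 0) :
    (ofStretch ha hb).toFun = stretch a b := by
  ext p <;> simp [ofStretch, toFun, base, lift, projV0, ofV0, expY, stretch]
  ring

/-- Shears as graph maps. -/
def ofShear (b : ℝ) : GraphMap where
  α := 1
  β := 1
  a := 0
  l := 0
  m := b
  c := 0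
  hα := one_ne_zero
  hβ := one_ne_zero

theorem ofShear_toFun (b : ℝ) : (ofShear b).toFun = shear b := by
  ext p <;> simp [ofShear, toFun, base, lift, projV0, ofV0, expY, shear]
  ring

end GraphMap

end Heis
end

theorem mainTheorem8 (Γ W : Set Heis) (hW : IsOpen W) (hΓ : Heis.IsEnergyMinimizingOn Γ W) :
    (∀ h : Heis,
      Heis.IsEnergyMinimizingOn ((fun p => h * p) '' Γ) ((fun p => h * p) '' W)) ∧
    (∀ a b : ℝ, a ≠ 0 → b ≠ 0 →
      Heis.IsEnergyMinimizingOn (Heis.stretch a b '' Γ) (Heis.stretch a b '' W)) ∧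
    (∀ b : ℝ,
      Heis.IsEnergyMinimizingOn (Heis.shear b '' Γ) (Heis.shear b '' W)) := by
  refine ⟨fun h => ?_, fun a b ha hb => ?_, fun b => ?_⟩
  · rw [← Heis.GraphMap.ofMulLeft_toFun]
    exact Heis.GraphMap.isEnergyMinimizingOn_image _ hΓ
  · rw [← Heis.GraphMap.ofStretch_toFun ha hb]
    exact Heis.GraphMap.isEnergyMinimizingOn_image _ hΓ
  · rw [← Heis.GraphMap.ofShear_toFun]
    exact Heis.GraphMap.isEnergyMinimizingOn_image _ hΓ
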